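/- Let $d\in\mathbb N$ and let $A=(A(n))_{n\in\mathbb N}$, $\mathbb N=\{0,1,2,\dots\}$, be a Lyapunov sequence in $\mathbb R^{d\times d}$, i.e. every $A(n)$ is invertible and both $(A(n))_{n}$ and $(A(n)^{-1})_{n}$ are bounded. Let $\mathcal L^\infty(\mathbb N,\mathbb R^{d\times d})$ be the Banach space of bounded sequences $Q=(Q(n))_{n\in\mathbb N}$ of real $d\times d$ matrices with norm $\|Q\|_\infty=\sup_{n}\|Q(n)\|$, where $\|\cdot\|$ is the Euclidean norm on $\mathbb R^d$ and the induced spectral norm on $\mathbb R^{d\times d}$. For a sequence $B=(B(n))_{n\in\mathbb N}$ in $\mathbb R^{d\times d}$ let $x_B(n,x_0)$ be the solution of $x(n+1)=B(n)x(n)$ with $x(0)=x_0\in\mathbb R^d$. The system $x(n+1)=B(n)x(n)$ has an *exponential dichotomy* if there are subspaces $L_1\oplus L_2=\mathbb R^d$ and constants $\alpha,K>0$ with $$\|x_B(n,x_0)\|\le K e^{-\alpha(n-m)}\|x_B(m,x_0)\|\quad (x_0\in L_1,\ n\ge m),$$ $$\|x_B(n,x_0)\|\ge K^{-1} e^{\alpha(n-m)}\|x_B(m,x_0)\|\quad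 (x_0\in L_2,\ n\ge m).$$ It has a *Bohl dichotomy* if there are subspaces $L_1\oplus L_2=\mathbb R^d$, $\alpha>0$ and functions $C_1,C_2:\mathbb R^d\to(0,\infty)$ with $$\|x_B(n,x_0)\|\le C_1(x_0) e^{-\alpha(n-m)}\|x_B(m,x_0)\|\quad (x_0\in L_1,\ n\ge m),$$ $$\|x_B(n,x_0)\|\ge C_2(x_0) e^{\alpha(n-m)}\|x_B(m,x_0)\|\quad (x_0\in L_2,\ n\ge m).$$ Put $$\Sigma_{\mathrm{ED}}(B)=\{\gamma\in\mathbb R: x(n+1)=e^{-\gamma}B(n)x(n)\text{ has no exponential dichotomy}\},$$ $$\Sigma_{\mathrm{BD}}(B)=\{\gamma\in\mathbb R: x(n+1)=e^{-\gamma}B(n)x(n)\text{ has no Bohl dichotomy}\}.$$ Then $$\bigcap_{\varepsilon>0}\ \bigcup_{\substack{Q\in\mathcal L^\infty(\mathbb N,\mathbb R^{d\times d})\\ \|Q\|_\infty<\varepsilon}}\Sigma_{\mathrm{BD}}(A+Q)=\Sigma_{\mathrm{ED}}(A).$$ -/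

import Mathlib

open scoped Matrix.Norms.L2Operator ENNReal

namespace BohlED

/-- Real `d × d` matrices. Their norm is the spectral norm, the operator norm induced by the
Euclidean norm (opened above from `Matrix.Norms.L2Operator`). -/
abbrev Mat (d : ℕ) : Type := Matrix (Fin d) (Fin d) ℝ

/-- The Banach space of bounded sequences `Q = (Q(k))_{k ∈ ℕ}` of real `d × d` matrices, with norm
`‖Q‖_∞ = sup_k ‖Q(k)‖`. -/
abbrev BddSeq (d : ℕ) : Type := lp (fun _ : ℕ => Mat d) ∞

/-- A Lyapunov sequence: every `A(n)` is invertible, and the sequences `A(n)` and `A(n)⁻¹` are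
bounded. -/
def IsLyapunovSequence {d : ℕ} (A : ℕ → Mat d) : Prop :=
  (∀ n, IsUnit (A n)) ∧
    Memℓp A ∞ ∧ Memℓp (fun n => (A n)⁻¹) ∞

/-- The solution `x(n, x₀)` of `x(n+1) = A(n) x(n)` with `x(0) = x₀`. -/
noncomputable def solution {d : ℕ} (A : ℕ → Mat d) (x₀ : EuclideanSpace ℝ (Fin d)) :
    ℕ → EuclideanSpace ℝ (Fin d)
  | 0 => x₀
  | n + 1 => Matrix.toEuclideanLin (A n) (solution A x₀ n)

/-- The system `x(n+1) = A(n) x(n)` has an exponential dichotomy. -/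
def HasExponentialDichotomy {d : ℕ} (A : ℕ → Mat d) : Prop :=
  ∃ L₁ L₂ : Submodule ℝ (EuclideanSpace ℝ (Fin d)), IsCompl L₁ L₂ ∧
    ∃ α : ℝ, 0 < α ∧ ∃ K : ℝ, 0 < K ∧
      (∀ x₀ ∈ L₁, ∀ m n : ℕ, m ≤ n →
        ‖solution A x₀ n‖ ≤ K * Real.exp (-α * ((n : ℝ) - (m : ℝ))) * ‖solution A x₀ m‖) ∧
      (∀ x₀ ∈ L₂, ∀ m n : ℕ, m ≤ n →
        K⁻¹ * Real.exp (α * ((n : ℝ) - (m : ℝ))) * ‖solution A x₀ m‖ ≤ ‖solution A x₀ n‖)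

/-- The system `x(n+1) = A(n) x(n)` has a Bohl dichotomy: the rate `α` is uniform, but the
constants may depend on the initial value `x₀` of the solution. -/
def HasBohlDichotomy {d : ℕ} (A : ℕ → Mat d) : Prop :=
  ∃ L₁ L₂ : Submodule ℝ (EuclideanSpace ℝ (Fin d)), IsCompl L₁ L₂ ∧
    ∃ α : ℝ, 0 < α ∧ ∃ C₁ C₂ : EuclideanSpace ℝ (Fin d) → ℝ,
      (∀ x, 0 < C₁ x) ∧ (∀ x, 0 < C₂ x) ∧
      (∀ x₀ ∈ L₁, ∀ m n : ℕ, m ≤ n →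
        ‖solution A x₀ n‖ ≤ C₁ x₀ * Real.exp (-α * ((n : ℝ) - (m : ℝ))) * ‖solution A x₀ m‖) ∧
      (∀ x₀ ∈ L₂, ∀ m n : ℕ, m ≤ n →
        C₂ x₀ * Real.exp (α * ((n : ℝ) - (m : ℝ))) * ‖solution A x₀ m‖ ≤ ‖solution A x₀ n‖)

/-- The exponential dichotomy spectrum `Σ_ED(A)`. -/
def expDichotomySpectrum {d : ℕ} (A : ℕ → Mat d) : Set ℝ :=
  {γ | ¬ HasExponentialDichotomy (fun n => Real.exp (-γ) • A n)}

/-- The Bohl dichotomy spectrum `Σ_BD(A)`. -/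
def bohlDichotomySpectrum {d : ℕ} (A : ℕ → Mat d) : Set ℝ :=
  {γ | ¬ HasBohlDichotomy (fun n => Real.exp (-γ) • A n)}

end BohlED

/-! Since $e^{-\gamma}A$ is again a Lyapunov sequence, it suffices to prove two statements for a
Lyapunov sequence $A$: an exponential dichotomy of $A$ gives a Bohl dichotomy of every $A+Q$ with
$Q$ small, and without an exponential dichotomy some arbitrarily small $Q$ leaves $A+Q$ without a
Bohl dichotomy. Everything is pulled back to time $0$ by the evolution operators $\Phi(n)$ of $A$.
With $\nu_n(x)=\|\Phi(n)x\|$, solutions of $A$ become constant sequences, and solutions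
$\Phi(n)x(n)$ of $A+Q$ become pseudo-orbits, moving at each step by a small amount relative to
$\nu_n$. Conversely, a pseudo-orbit without zeros comes from a small $Q$ of rank at most one.

Persistence (`exists_pseudoOrbit_dichotomy`): a pseudo-orbit either stays for ever in the cone
around the stable space, and decays, or leaves it at some time $m_0$, and grows from then on. Rates
are uniform, but the growth constant depends on $m_0$; a Bohl dichotomy allows this.

Destruction (`dichotomyOn_of_pseudoOrbits`): a solution with arbitrarily long stretches of slow
growth, starting arbitrarily late, and arbitrarily long stretches of slow decay excludes a Bohl
dichotomy. If no pseudo-orbit behaves so, a dichotomy is built on every subspace $W$ by induction on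
dimension. Unless $W$ decays uniformly, some state $y$ has only fast-growing reachable vectors. The
unreachable vectors form a proper subspace (`unreachable`, by way of `Reach.dominates`), to which
induction applies; a complement of it grows uniformly and stays at a positive angle to it. -/

namespace BohlED

/-! ### Scalar sequences. -/

/-- Uniform exponential growth with explicit constants, from doubling over windows of a fixed
length that start late enough. -/
theorem exp_growth_of_doubling {a : ℕ → ℝ} {M : ℝ} (hM : 1 ≤ M) {N T : ℕ} (hN : 0 < N)
    (ha : ∀ n, 0 ≤ a n) (hback : ∀ n, a n ≤ M * a (n + 1))
    (hdouble : ∀ m, T ≤ m → 2 * a m ≤ a (m + N)) (m n : ℕ) (hmn : m ≤ n) :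
    (M ^ (N + T) * Real.exp (Real.log 2 / N * (N + T)))⁻¹ *
      Real.exp (Real.log 2 / N * ((n : ℝ) - m)) * a m ≤ a n := by
  obtain ⟨j, rfl⟩ := Nat.exists_eq_add_of_le hmn
  have hM0 : 0 < M := by linarith
  have hN' : (0 : ℝ) < N := by exact_mod_cast hN
  set α := Real.log 2 / N with hα
  have hα0 : 0 < α := div_pos (Real.log_pos (by norm_num)) hN'
  have hαN : Real.exp (α * N) = 2 := by
    rw [hα, div_mul_cancel₀ _ hN'.ne', Real.exp_log (by norm_num)]
  have hpow : ∀ i, a m ≤ M ^ i * a (m + i) := by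
    intro i
    induction i with
    | zero => simp
    | succ i ih =>
      calc a m ≤ M ^ i * a (m + i) := ih
        _ ≤ M ^ i * (M * a (m + i + 1)) := by gcongr; exact hback _
        _ = M ^ (i + 1) * a (m + (i + 1)) := by rw [pow_succ, mul_assoc, add_assoc]
  have key : ∀ j : ℕ, Real.exp (α * j) * a m ≤
      M ^ (N + T) * Real.exp (α * (N + T)) * a (m + j) := by
    intro j
    induction j using Nat.strong_induction_on with
    | _ j ih =>
      rcases lt_or_ge j (N + T) with hj | hj
      · have h1 : Real.exp (α * j) ≤ Real.exp (α * (N + T)) := by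
          apply Real.exp_le_exp.mpr
          have : (j : ℝ) ≤ N + T := by exact_mod_cast hj.le
          gcongr
        have h2 : a m ≤ M ^ (N + T) * a (m + j) := (hpow j).trans (by
          have := ha (m + j)
          gcongr)
        calc _ ≤ Real.exp (α * (N + T)) * (M ^ (N + T) * a (m + j)) := by
              have := ha m
              gcongr
          _ = _ := by ring
      -- The last window is peeled off, not the first: $j-N\ge T$ makes it start late enough even
      -- when $m$ is small.
      · have h1 := ih (j - N) (by omega)
        have h2 := hdouble (m + (j - N)) (by omega)
        rw [show m + (j - N) + N = m + j by omega] at h2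
        have h3 : Real.exp (α * j) = 2 * Real.exp (α * ((j - N : ℕ) : ℝ)) := by
          rw [← hαN, ← Real.exp_add, Nat.cast_sub (by omega)]
          congr 1
          ring
        rw [h3]
        have h4 : 0 < M ^ (N + T) * Real.exp (α * (N + T)) := by positivity
        nlinarith
  have h := key j
  have h4 : 0 < M ^ (N + T) * Real.exp (α * (N + T)) := by positivity
  rw [mul_assoc, inv_mul_le_iff₀ h4]
  simpa using h

/-- Uniform exponential decay with explicit constants, from halving over windows of a fixed
length that start late enough. -/
theorem exp_decay_of_halving {a : ℕ → ℝ} {M : ℝ} (hM : 1 ≤ M) {N T : ℕ} (hN : 0 < N)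
    (ha : ∀ n, 0 ≤ a n) (hforw : ∀ n, a (n + 1) ≤ M * a n)
    (hhalf : ∀ m, T ≤ m → a (m + N) ≤ 1 / 2 * a m) (m n : ℕ) (hmn : m ≤ n) :
    a n ≤ M ^ (N + T) * Real.exp (Real.log 2 / N * (N + T)) *
      Real.exp (-(Real.log 2 / N) * ((n : ℝ) - m)) * a m := by
  obtain ⟨j, rfl⟩ := Nat.exists_eq_add_of_le hmn
  have hM0 : 0 < M := by linarith
  have hN' : (0 : ℝ) < N := by exact_mod_cast hN
  set α := Real.log 2 / N with hα
  have hα0 : 0 < α := div_pos (Real.log_pos (by norm_num)) hN'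
  have hαN : Real.exp (α * N) = 2 := by
    rw [hα, div_mul_cancel₀ _ hN'.ne', Real.exp_log (by norm_num)]
  have hpow : ∀ i, a (m + i) ≤ M ^ i * a m := by
    intro i
    induction i with
    | zero => simp
    | succ i ih =>
      calc a (m + i + 1) ≤ M * a (m + i) := hforw _
        _ ≤ M * (M ^ i * a m) := by gcongr
        _ = M ^ (i + 1) * a m := by ring
  have key : ∀ j : ℕ, Real.exp (α * j) * a (m + j) ≤
      M ^ (N + T) * Real.exp (α * (N + T)) * a m := by
    intro j
    induction j using Nat.strong_induction_on with
    | _ j ih =>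
      rcases lt_or_ge j (N + T) with hj | hj
      · have h1 : Real.exp (α * j) ≤ Real.exp (α * (N + T)) := by
          apply Real.exp_le_exp.mpr
          have : (j : ℝ) ≤ N + T := by exact_mod_cast hj.le
          gcongr
        have h2 : a (m + j) ≤ M ^ (N + T) * a m := (hpow j).trans (by
          have := ha m
          gcongr)
        calc _ ≤ Real.exp (α * (N + T)) * (M ^ (N + T) * a m) := by
              have := ha (m + j)
              gcongr
          _ = _ := by ring
      · have h1 := ih (j - N) (by omega)
        have h2 := hhalf (m + (j - N)) (by omega)
        rw [show m + (j - N) + N = m + j by omega] at h2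
        have h3 : Real.exp (α * j) = 2 * Real.exp (α * ((j - N : ℕ) : ℝ)) := by
          rw [← hαN, ← Real.exp_add, Nat.cast_sub (by omega)]
          congr 1
          ring
        rw [h3]
        have h4 := Real.exp_pos (α * ((j - N : ℕ) : ℝ))
        nlinarith
  have h := key j
  rw [neg_mul, Real.exp_neg, Nat.cast_add, add_sub_cancel_left, mul_right_comm,
    ← div_eq_mul_inv, le_div_iff₀ (Real.exp_pos _)]
  linarith

/-! ### Sequences of norms and their dichotomies. -/

section Norms

variable {X : Type*} [NormedAddCommGroup X] [NormedSpace ℝ X]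

/-- A sequence of norms on a vector space, all continuous, with consecutive ones comparable. -/
structure ComparableNorms (ν : ℕ → Seminorm ℝ X) (M : ℝ) : Prop where
  one_le : 1 ≤ M
  pos : ∀ n x, x ≠ 0 → 0 < ν n x
  forward : ∀ n x, ν (n + 1) x ≤ M * ν n x
  backward : ∀ n x, ν n x ≤ M * ν (n + 1) x
  cont : ∀ n, Continuous (ν n)

/-- Uniform exponential decay of `ν n x` in `n`, for `x` in a subspace. -/
def UniformDecay (ν : ℕ → Seminorm ℝ X) (L : Submodule ℝ X) (α K : ℝ) : Prop :=
  ∀ x ∈ L, ∀ m n : ℕ, m ≤ n → ν n x ≤ K * Real.exp (-α * ((n : ℝ) - m)) * ν m x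

/-- Uniform exponential growth of `ν n x` in `n`, for `x` in a subspace. -/
def UniformGrowth (ν : ℕ → Seminorm ℝ X) (L : Submodule ℝ X) (α K : ℝ) : Prop :=
  ∀ x ∈ L, ∀ m n : ℕ, m ≤ n → K⁻¹ * Real.exp (α * ((n : ℝ) - m)) * ν m x ≤ ν n x

/-- An exponential dichotomy of the norms `ν n` on the subspace `W`. -/
def DichotomyOn (ν : ℕ → Seminorm ℝ X) (W : Submodule ℝ X) : Prop :=
  ∃ L₁ L₂ : Submodule ℝ X, Disjoint L₁ L₂ ∧ L₁ ⊔ L₂ = W ∧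
    ∃ α : ℝ, 0 < α ∧ ∃ K : ℝ, 0 < K ∧ UniformDecay ν L₁ α K ∧ UniformGrowth ν L₂ α K

variable {ν : ℕ → Seminorm ℝ X} {M ε : ℝ}

theorem UniformDecay.mono {L : Submodule ℝ X} {α α' K K' : ℝ} (h : UniformDecay ν L α K)
    (hα : α' ≤ α) (hK : K ≤ K') (hK0 : 0 ≤ K) : UniformDecay ν L α' K' := by
  intro x hx m n hmn
  refine (h x hx m n hmn).trans ?_
  have h1 : (0 : ℝ) ≤ n - m := sub_nonneg.mpr (by exact_mod_cast hmn)
  have h2 := apply_nonneg (ν m) x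
  have h3 := hK0.trans hK
  gcongr

theorem UniformGrowth.mono {L : Submodule ℝ X} {α α' K K' : ℝ} (h : UniformGrowth ν L α K)
    (hα : α' ≤ α) (hK : K ≤ K') (hK0 : 0 < K) : UniformGrowth ν L α' K' := by
  intro x hx m n hmn
  refine le_trans ?_ (h x hx m n hmn)
  have h1 : (0 : ℝ) ≤ n - m := sub_nonneg.mpr (by exact_mod_cast hmn)
  have h2 := apply_nonneg (ν m) x
  gcongr

theorem ComparableNorms.exists_uniformGrowth (hν : ComparableNorms ν M) {L : Submodule ℝ X}
    {N T : ℕ} (hN : 0 < N) (h : ∀ m, T ≤ m → ∀ x ∈ L, 2 * ν m x ≤ ν (m + N) x) :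
    ∃ α : ℝ, 0 < α ∧ ∃ K : ℝ, 0 < K ∧ UniformGrowth ν L α K := by
  have hM0 : 0 < M := by linarith [hν.one_le]
  refine ⟨Real.log 2 / N, div_pos (Real.log_pos (by norm_num)) (by exact_mod_cast hN),
    M ^ (N + T) * Real.exp (Real.log 2 / N * (N + T)), by positivity, ?_⟩
  intro x hx m n hmn
  exact exp_growth_of_doubling hν.one_le hN (fun n => apply_nonneg (ν n) x)
    (fun n => hν.backward n x) (fun m hm => h m hm x hx) m n hmn

theorem ComparableNorms.exists_uniformDecay (hν : ComparableNorms ν M) {L : Submodule ℝ X}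
    {N T : ℕ} (hN : 0 < N) (h : ∀ m, T ≤ m → ∀ x ∈ L, ν (m + N) x ≤ 1 / 2 * ν m x) :
    ∃ α : ℝ, 0 < α ∧ ∃ K : ℝ, 0 < K ∧ UniformDecay ν L α K := by
  have hM0 : 0 < M := by linarith [hν.one_le]
  refine ⟨Real.log 2 / N, div_pos (Real.log_pos (by norm_num)) (by exact_mod_cast hN),
    M ^ (N + T) * Real.exp (Real.log 2 / N * (N + T)), by positivity, ?_⟩
  intro x hx m n hmn
  exact exp_decay_of_halving hν.one_le hN (fun n => apply_nonneg (ν n) x)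
    (fun n => hν.forward n x) (fun m hm => h m hm x hx) m n hmn

/-! ### Reachability by small relative steps. -/

/-- `Reach ν ε W m y n z`: the vector `z` at time `n` can be reached from `y` at time `m` by steps
in `W` of relative size at most `ε`. -/
inductive Reach (ν : ℕ → Seminorm ℝ X) (ε : ℝ) (W : Submodule ℝ X) (m : ℕ) (y : X) :
    ℕ → X → Prop
  | refl : Reach ν ε W m y m y
  | step {n : ℕ} {z z' : X} : Reach ν ε W m y n z → z' ∈ W → ν n (z' - z) ≤ ε * ν n z →
      Reach ν ε W m y (n + 1) z'

variable {W : Submodule ℝ X} {m n : ℕ} {y z : X}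

theorem Reach.mem (hy : y ∈ W) (h : Reach ν ε W m y n z) : z ∈ W := by
  cases h <;> assumption

theorem Reach.le (h : Reach ν ε W m y n z) : m ≤ n := by
  induction h with
  | refl => exact le_rfl
  | step _ _ _ ih => omega

theorem Reach.ne_zero (hν : ComparableNorms ν M) (hε : ε < 1) (hy : y ≠ 0)
    (h : Reach ν ε W m y n z) : z ≠ 0 := by
  induction h with
  | refl => exact hy
  | @step n z z' _ _ h2 ih =>
    rintro rfl
    rw [zero_sub, map_neg_eq_map] at h2
    nlinarith [hν.pos n z ih]

theorem Reach.smul (h : Reach ν ε W m y n z) (a : ℝ) : Reach ν ε W m (a • y) n (a • z) := by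
  induction h with
  | refl => exact .refl
  | step _ h1 h2 ih =>
    refine ih.step (W.smul_mem a h1) ?_
    rw [← smul_sub, map_smul_eq_mul, map_smul_eq_mul]
    nlinarith [norm_nonneg a]

theorem Reach.wait (hε : 0 ≤ ε) (hy : y ∈ W) (h : Reach ν ε W m y n z) {n' : ℕ} (hn : n ≤ n') :
    Reach ν ε W m y n' z := by
  induction n', hn using Nat.le_induction with
  | base => exact h
  | succ k _ ih =>
    refine ih.step (h.mem hy) ?_
    rw [sub_self, map_zero]
    exact mul_nonneg hε (apply_nonneg _ _)

/-- `x` is an orbit up to perturbations of relative size `ε`. -/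
def IsPseudoOrbit (ν : ℕ → Seminorm ℝ X) (ε : ℝ) (x : ℕ → X) : Prop :=
  ∀ n, ν n (x (n + 1) - x n) ≤ ε * ν n (x n)

/-- A pseudo-orbit can be redirected at time `m` to any state reachable from its state there. -/
theorem Reach.exists_isPseudoOrbit (hε : 0 ≤ ε) {x : ℕ → X} (hx : IsPseudoOrbit ν ε x)
    (hxW : ∀ j, x j ∈ W) (h : Reach ν ε W m (x m) n z) :
    ∃ x', IsPseudoOrbit ν ε x' ∧ (∀ j, x' j ∈ W) ∧ (∀ j ≤ m, x' j = x j) ∧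
      ∀ j, n ≤ j → x' j = z := by
  have main : ∀ (x : ℕ → X) (p : ℕ) (w : X), IsPseudoOrbit ν ε x → (∀ j, x j ∈ W) → w ∈ W →
      (∀ n, p = n + 1 → ν n (w - x n) ≤ ε * ν n (x n)) →
      IsPseudoOrbit ν ε (fun j => if j < p then x j else w) ∧
        ∀ j, (if j < p then x j else w) ∈ W := by
    intro x p w hx hxW hw hp
    refine ⟨fun j => ?_, fun j => by split_ifs <;> simp [hxW, hw]⟩
    have h0 : ν j (0 : X) ≤ ε * ν j w := by
      rw [map_zero]
      exact mul_nonneg hε (apply_nonneg _ _)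
    rcases lt_trichotomy (j + 1) p with hj | hj | hj
    · simpa [hj, show j < p by omega] using hx j
    · simpa [hj, show j < p by omega] using hp j hj.symm
    · simpa [show ¬ j < p by omega, show ¬ j + 1 < p by omega] using h0
  induction h with
  | refl =>
    obtain ⟨h1, h2⟩ := main x m (x m) hx hxW (hxW m) (by rintro n rfl; exact hx n)
    refine ⟨_, h1, h2, ?_, ?_⟩
    · intro j hj
      by_cases h : j < m
      · simp [h]
      · simp [show j = m by omega]
    · intro j hj
      simp [show ¬ j < m by omega]
  | @step n z z' h0 h1 h2 ih =>
    obtain ⟨x', hx', hxW', hagree, hz⟩ := ih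
    obtain ⟨h3, h4⟩ := main x' (n + 1) z' hx' hxW' h1 (by
      rintro k hk
      obtain rfl : n = k := by omega
      rwa [hz n le_rfl])
    refine ⟨_, h3, h4, ?_, ?_⟩
    · intro j hj
      have := h0.le
      simp [show j < n + 1 by omega, hagree j hj]
    · intro j hj
      simp [show ¬ j < n + 1 by omega]

/-- If `w` is reachable and no nonzero multiple of `z` is, then `w` outgrows `z` exponentially. -/
theorem Reach.dominates (hν : ComparableNorms ν M) (hε : 0 < ε) (hε1 : ε < 1) {w : X}
    (hy0 : y ≠ 0) (hy : y ∈ W) (hw : Reach ν ε W m y n w) (hz : z ∈ W)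
    (hzE : ∀ p, ∀ a : ℝ, a ≠ 0 → ¬ Reach ν ε W m y p (a • z)) :
    ∃ C : ℝ, ∀ j : ℕ, ν (n + 1 + j) z ≤ C * (1 - ε ^ 2) ^ j * ν (n + 1 + j) w := by
  rcases eq_or_ne z 0 with rfl | hz0
  · exact ⟨0, fun j => by simp⟩
  have hw0 := hw.ne_zero hν hε1 hy0
  have hwW := hw.mem hy
  -- The largest multiple of $z$ that one admissible step from $w$ can add.
  set δ := ε * ν n w / ν n z with hδ
  have hδ0 : 0 < δ := div_pos (mul_pos hε (hν.pos _ _ hw0)) (hν.pos _ _ hz0)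
  have hτ : 0 < 1 - ε ^ 2 := by nlinarith
  have hreach : ∀ j : ℕ, Reach ν ε W m y (n + 1 + j) ((1 - ε ^ 2) ^ j • w + δ • z) := by
    intro j
    induction j with
    | zero =>
      refine hw.step (W.add_mem (W.smul_mem _ hwW) (W.smul_mem _ hz)) ?_
      rw [pow_zero, one_smul, add_sub_cancel_left, map_smul_eq_mul, Real.norm_of_nonneg hδ0.le,
        hδ, div_mul_cancel₀ _ (hν.pos _ _ hz0).ne']
    | succ j ih =>
      refine ih.step (W.add_mem (W.smul_mem _ hwW) (W.smul_mem _ hz)) ?_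
      set q := (1 - ε ^ 2) ^ j with hq
      have hq0 : 0 < q := pow_pos hτ j
      have h1 : (1 - ε ^ 2) ^ (j + 1) • w + δ • z - (q • w + δ • z) = -((ε ^ 2 * q) • w) := by
        rw [pow_succ, ← hq]
        module
      rw [h1, map_neg_eq_map, map_smul_eq_mul, Real.norm_of_nonneg (by positivity)]
      by_contra! hlt
      apply hzE (n + 1 + j + 1) (-(δ / q)) (by simp [hδ0.ne', hq0.ne'])
      refine (hw.wait hε.le hy (show n ≤ n + 1 + j by omega)).step
        (W.smul_mem _ hz) ?_
      have h2 : -(δ / q) • z - w = (-q⁻¹) • (q • w + δ • z) := by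
        rw [smul_add, smul_smul, smul_smul, neg_mul, neg_mul, inv_mul_cancel₀ hq0.ne',
          ← div_eq_inv_mul]
        module
      rw [h2, map_smul_eq_mul, norm_neg, norm_inv, Real.norm_of_nonneg hq0.le,
        inv_mul_le_iff₀ hq0]
      have h3 : ε * ν (n + 1 + j) (q • w + δ • z) ≤ ε * (q * (ε * ν (n + 1 + j) w)) := by
        linarith
      exact le_of_mul_le_mul_left h3 hε
  refine ⟨(1 + ε) / (ε * δ), fun j => ?_⟩
  set q := (1 - ε ^ 2) ^ j with hq
  have hq0 : 0 < q := pow_pos hτ j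
  set t := n + 1 + j with ht
  -- Otherwise dropping $qw$ is an admissible step and lands on $\delta z$.
  have h1 : ε * ν t (q • w + δ • z) ≤ q * ν t w := by
    by_contra! hlt
    apply hzE (t + 1) δ hδ0.ne'
    refine (hreach j).step (W.smul_mem _ hz) ?_
    rw [show δ • z - (q • w + δ • z) = -(q • w) by module, map_neg_eq_map, map_smul_eq_mul,
      Real.norm_of_nonneg hq0.le]
    exact hlt.le
  have h2 : ν t (δ • z) ≤ ν t (q • w + δ • z) + ν t (q • w) := by
    have := map_sub_le_add (ν t) (q • w + δ • z) (q • w)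
    rwa [add_sub_cancel_left] at this
  rw [map_smul_eq_mul, map_smul_eq_mul, Real.norm_of_nonneg hq0.le,
    Real.norm_of_nonneg hδ0.le] at h2
  rw [div_mul_eq_mul_div, div_mul_eq_mul_div, le_div_iff₀ (by positivity)]
  nlinarith [apply_nonneg (ν t) w]

/-- The vectors of `W` no nonzero multiple of which is reachable form a subspace. -/
def unreachable (hν : ComparableNorms ν M) (hε : 0 < ε) (hε1 : ε < 1) (hy0 : y ≠ 0)
    (hy : y ∈ W) (m : ℕ) : Submodule ℝ X where
  carrier := {z | z ∈ W ∧ ∀ p, ∀ a : ℝ, a ≠ 0 → ¬ Reach ν ε W m y p (a • z)}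
  zero_mem' := ⟨W.zero_mem, fun p a _ h => h.ne_zero hν hε1 hy0 (smul_zero a)⟩
  smul_mem' := by
    rintro c z ⟨hz, hzE⟩
    refine ⟨W.smul_mem c hz, fun p a ha h => ?_⟩
    rcases eq_or_ne c 0 with rfl | hc
    · exact h.ne_zero hν hε1 hy0 (by simp)
    · rw [smul_smul] at h
      exact hzE p _ (mul_ne_zero ha hc) h
  add_mem' := by
    rintro z z' ⟨hz, hzE⟩ ⟨hz', hzE'⟩
    refine ⟨W.add_mem hz hz', fun p a ha h => ?_⟩
    have hsc : ∀ z : X, (∀ p, ∀ a : ℝ, a ≠ 0 → ¬ Reach ν ε W m y p (a • z)) →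
        ∀ p, ∀ b : ℝ, b ≠ 0 → ¬ Reach ν ε W m y p (b • a • z) := by
      intro z hz p b hb
      rw [smul_smul]
      exact hz p _ (mul_ne_zero hb ha)
    -- The reachable vector $a(z+z')$ would dominate both its summands, hence eventually exceed
    -- their sum in norm.
    obtain ⟨C, hC⟩ := h.dominates hν hε hε1 hy0 hy (W.smul_mem a hz) (hsc z hzE)
    obtain ⟨C', hC'⟩ := h.dominates hν hε hε1 hy0 hy (W.smul_mem a hz') (hsc z' hzE')
    have hτ : 0 < 1 - ε ^ 2 := by nlinarith
    have hlim : Filter.Tendsto (fun j : ℕ => (C + C') * (1 - ε ^ 2) ^ j) Filter.atTop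
        (nhds ((C + C') * 0)) :=
      (tendsto_pow_atTop_nhds_zero_of_lt_one hτ.le (by nlinarith)).const_mul _
    rw [mul_zero] at hlim
    obtain ⟨j, hj⟩ := (hlim.eventually (gt_mem_nhds one_pos)).exists
    have h1 := map_add_le_add (ν (p + 1 + j)) (a • z) (a • z')
    rw [← smul_add] at h1
    nlinarith [hν.pos (p + 1 + j) _ (h.ne_zero hν hε1 hy0), hC j, hC' j]

/-- A subspace all of whose nonzero vectors are eventually reachable is so at a common time. -/
theorem exists_uniform_reach [FiniteDimensional ℝ X] (hν : ComparableNorms ν M) (hε : 0 < ε)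
    (hy : y ∈ W) (F : Submodule ℝ X) (hFW : F ≤ W)
    (hF : ∀ z ∈ F, z ≠ 0 → ∃ p, ∃ a : ℝ, a ≠ 0 ∧ Reach ν ε W m y p (a • z)) :
    ∃ T, ∀ p, T ≤ p → ∀ z ∈ F, z ≠ 0 → ∃ a : ℝ, a ≠ 0 ∧ Reach ν ε W m y p (a • z) := by
  have hcpt : IsCompact ((F : Set X) ∩ Metric.sphere 0 1) :=
    (isCompact_sphere 0 1).inter_left F.closed_of_finiteDimensional
  have main : ∃ T, ∀ z ∈ (F : Set X) ∩ Metric.sphere 0 1,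
      z ∈ W → ∃ a : ℝ, a ≠ 0 ∧ Reach ν ε W m y T (a • z) := by
    refine hcpt.induction_on (p := fun s => ∃ T, ∀ z ∈ s,
      z ∈ W → ∃ a : ℝ, a ≠ 0 ∧ Reach ν ε W m y T (a • z)) ⟨0, by simp⟩ ?_ ?_ ?_
    · rintro s t hst ⟨T, hT⟩
      exact ⟨T, fun z hz => hT z (hst hz)⟩
    · rintro s t ⟨T, hT⟩ ⟨T', hT'⟩
      refine ⟨max T T', ?_⟩
      rintro z (hz | hz) hzW
      · obtain ⟨a, ha, h⟩ := hT z hz hzW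
        exact ⟨a, ha, h.wait hε.le hy (le_max_left _ _)⟩
      · obtain ⟨a, ha, h⟩ := hT' z hz hzW
        exact ⟨a, ha, h.wait hε.le hy (le_max_right _ _)⟩
    · rintro z ⟨hzF, hz1⟩
      have hz0 : z ≠ 0 := by
        rintro rfl
        simp at hz1
      obtain ⟨p, a, ha, h⟩ := hF z hzF hz0
      -- One further step leads from a multiple of $z$ to the same multiple of any nearby vector, so
      -- time $p+1$ serves a whole neighbourhood.
      refine ⟨{z' | ν p (z' - z) < ε * ν p z}, mem_nhdsWithin_of_mem_nhds ?_, p + 1, ?_⟩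
      · refine IsOpen.mem_nhds (isOpen_lt ((hν.cont p).comp (by fun_prop)) continuous_const) ?_
        simpa using mul_pos hε (hν.pos p z hz0)
      · intro z' hz' hz'W
        refine ⟨a, ha, h.step (W.smul_mem a hz'W) ?_⟩
        rw [← smul_sub, map_smul_eq_mul, map_smul_eq_mul]
        have : ν p (z' - z) < ε * ν p z := hz'
        nlinarith [norm_nonneg a]
  obtain ⟨T, hT⟩ := main
  refine ⟨T, fun p hp z hzF hz0 => ?_⟩
  have hn : ‖z‖ ≠ 0 := norm_ne_zero_iff.mpr hz0
  obtain ⟨a, ha, h⟩ := hT (‖z‖⁻¹ • z) ⟨F.smul_mem _ hzF, by simp [norm_smul, hn]⟩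
    (W.smul_mem _ (hFW hzF))
  rw [smul_smul] at h
  exact ⟨_, mul_ne_zero ha (inv_ne_zero hn), h.wait hε.le hy hp⟩

/-! ### Pseudo-orbits with both slow growth and slow decay. -/

/-- If from every state of `W` one can reach long intervals of bounded growth as well as long
intervals of bounded decay, then some pseudo-orbit has infinitely many of both kinds. -/
theorem exists_nondichotomous_pseudoOrbit (hν : ComparableNorms ν M) (hε : 0 < ε) (hε1 : ε < 1)
    {c : ℝ} (hy0 : y ≠ 0) (hy : y ∈ W)
    (hG : ∀ m, ∀ y ∈ W, y ≠ 0 → ∀ k : ℕ, ∃ n z, Reach ν ε W m y n z ∧ ν (n + k) z ≤ 2 * ν n z)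
    (hD : ∀ m, ∀ y ∈ W, y ≠ 0 → ∀ k : ℕ, 0 < k → ∃ n z z', Reach ν ε W m y n z ∧
      Reach ν ε W n z (n + k) z' ∧ c * ν n z ≤ ν (n + k) z') :
    ∃ x : ℕ → X, IsPseudoOrbit ν ε x ∧ (∀ n, x n ≠ 0) ∧
      (∀ k, ∃ n, k ≤ n ∧ ν (n + (k + 1)) (x (n + (k + 1))) ≤ 2 * ν n (x n)) ∧
      (∀ k, ∃ n, c * ν n (x n) ≤ ν (n + (k + 1)) (x (n + (k + 1)))) := by
  have hne : ∀ x : ℕ → X, IsPseudoOrbit ν ε x → (∀ n, x n ∈ W) → x 0 = y → ∀ n, x n ≠ 0 := by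
    intro x hx hxW h0 n
    have : Reach ν ε W 0 (x 0) n (x n) := by
      induction n with
      | zero => exact .refl
      | succ n ih => exact ih.step (hxW _) (hx n)
    exact this.ne_zero hν hε1 (h0 ▸ hy0)
  let S := {p : ℕ × (ℕ → X) // IsPseudoOrbit ν ε p.2 ∧ (∀ n, p.2 n ∈ W) ∧ p.2 0 = y}
  have hnext : ∀ (k : ℕ) (s : S), ∃ s' : S, s.1.1 < s'.1.1 ∧
      (∀ j ≤ s.1.1, s'.1.2 j = s.1.2 j) ∧
      (∃ n, s.1.1 ≤ n ∧ n + (k + 1) ≤ s'.1.1 ∧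
        ν (n + (k + 1)) (s'.1.2 (n + (k + 1))) ≤ 2 * ν n (s'.1.2 n)) ∧
      (∃ n, n + (k + 1) ≤ s'.1.1 ∧
        c * ν n (s'.1.2 n) ≤ ν (n + (k + 1)) (s'.1.2 (n + (k + 1)))) := by
    rintro k ⟨⟨m, x⟩, hx, hxW, hx0⟩
    obtain ⟨n, z, hz, hgz⟩ := hG m (x m) (hxW m) (hne x hx hxW hx0 m) (k + 1)
    obtain ⟨x₁, h1, h1W, h1a, h1z⟩ := hz.exists_isPseudoOrbit hε.le hx hxW
    have h1m : x₁ (n + (k + 1)) = z := h1z _ (by omega)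
    have h10 : x₁ 0 = y := (h1a 0 (Nat.zero_le _)).trans hx0
    obtain ⟨p, w, w', hw, hw', hdw⟩ := hD (n + (k + 1)) (x₁ (n + (k + 1))) (h1W _)
      (hne x₁ h1 h1W h10 _) (k + 1) k.succ_pos
    obtain ⟨x₂, h2, h2W, h2a, h2w⟩ := hw.exists_isPseudoOrbit hε.le h1 h1W
    rw [← h2w p le_rfl] at hw'
    obtain ⟨x₃, h3, h3W, h3a, h3w⟩ := hw'.exists_isPseudoOrbit hε.le h2 h2W
    have hmn := hz.le
    have hnp := hw.le
    have hx31 : ∀ j ≤ n + (k + 1), x₃ j = x₁ j := fun j hj =>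
      (h3a j (by omega)).trans (h2a j hj)
    refine ⟨⟨⟨p + (k + 1), x₃⟩, h3, h3W, (hx31 0 (by omega)).trans h10⟩, ?_, ?_,
      ⟨n, hmn, ?_, ?_⟩, p, le_rfl, ?_⟩
    · change m < p + (k + 1)
      omega
    · intro j hj
      change j ≤ m at hj
      exact (hx31 j (by omega)).trans (h1a j hj)
    · change n + (k + 1) ≤ p + (k + 1)
      omega
    · change ν (n + (k + 1)) (x₃ (n + (k + 1))) ≤ 2 * ν n (x₃ n)
      rw [hx31 _ le_rfl, hx31 n (by omega), h1m, h1z n le_rfl]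
      exact hgz
    · change c * ν p (x₃ p) ≤ ν (p + (k + 1)) (x₃ (p + (k + 1)))
      rw [h3a p le_rfl, h2w p le_rfl, h3w _ le_rfl]
      exact hdw
  choose next hlt hagree hgrow hdecay using hnext
  let s₀ : S := ⟨⟨0, fun _ => y⟩, fun n => by
    simpa using mul_nonneg hε.le (apply_nonneg (ν n) y), fun _ => hy, rfl⟩
  let s : ℕ → S := fun n => Nat.rec s₀ next n
  have hs : ∀ k, s (k + 1) = next k (s k) := fun _ => rfl
  have hmono : StrictMono fun k => (s k).1.1 := strictMono_nat_of_lt_succ fun k => by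
    rw [hs]
    exact hlt k (s k)
  have hle : ∀ k, k ≤ (s k).1.1 := fun _ => hmono.le_apply
  have hcoh : ∀ k l, k ≤ l → ∀ j ≤ (s k).1.1, (s l).1.2 j = (s k).1.2 j := by
    intro k l hkl j hj
    induction l, hkl using Nat.le_induction with
    | base => rfl
    | succ l hkl ih =>
      rw [hs, hagree l (s l) j (hj.trans (hmono.monotone hkl)), ih]
  -- The diagonal is consistent because stage $n$ is already final at time $n$.
  let x : ℕ → X := fun n => (s n).1.2 n
  have hxs : ∀ k j, j ≤ (s k).1.1 → x j = (s k).1.2 j := by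
    intro k j hj
    rcases le_total k j with h | h
    · exact hcoh k j h j hj
    · exact (hcoh j k h j (hle j)).symm
  have hx : IsPseudoOrbit ν ε x := fun n => by
    rw [hxs (n + 1) n ((Nat.le_succ n).trans (hle _)), hxs (n + 1) (n + 1) (hle _)]
    exact (s (n + 1)).2.1 n
  refine ⟨x, hx, hne x hx (fun n => (s n).2.2.1 n) s₀.2.2.2, fun k => ?_, fun k => ?_⟩
  · obtain ⟨n, h1, h2, h3⟩ := hgrow k (s k)
    rw [← hs] at h2 h3
    refine ⟨n, (hle k).trans h1, ?_⟩
    rwa [hxs (k + 1) _ h2, hxs (k + 1) n (by omega)]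
  · obtain ⟨n, h2, h3⟩ := hdecay k (s k)
    rw [← hs] at h2 h3
    refine ⟨n, ?_⟩
    rwa [hxs (k + 1) _ h2, hxs (k + 1) n (by omega)]

/-- If some vector of `W` keeps `1 / 2` of its norm over a long interval, every state can be
steered to keep a fixed part of its norm. -/
theorem exists_reach_slow_decay (hν : ComparableNorms ν M) (hε : 0 < ε)
    (hW : ∀ N T : ℕ, 0 < N → ∃ m, T ≤ m ∧ ∃ x ∈ W, 1 / 2 * ν m x < ν (m + N) x)
    (hy : y ∈ W) {k : ℕ} (hk : 0 < k) : ∃ n z z', Reach ν ε W m y n z ∧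
      Reach ν ε W n z (n + k) z' ∧ ε / 8 * ν n z ≤ ν (n + k) z' := by
  obtain ⟨t, hmt, v, hv, hvt⟩ := hW k m hk
  have hyt : Reach ν ε W m y t y := Reach.refl.wait hε.le hy hmt
  by_cases h : ε / 8 * ν t y ≤ ν (t + k) y
  · exact ⟨t, y, y, hyt, Reach.refl.wait hε.le hy (Nat.le_add_right _ _), h⟩
  push Not at h
  have hv0 : v ≠ 0 := by
    rintro rfl
    simp at hvt
  have hvp := hν.pos t v hv0
  -- Waiting at $y$ loses too much, so add the largest admissible multiple of $v$: it keeps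
  -- $\varepsilon/2$ of $\nu_t(y)$, of which $y$ cancels at most $\varepsilon/8$.
  set s := ε * ν t y / ν t v with hs
  have hs0 : 0 ≤ s := by positivity
  have hsv : s * ν t v = ε * ν t y := div_mul_cancel₀ _ hvp.ne'
  refine ⟨t, y, y + s • v, hyt, ?_, ?_⟩
  · have h1 : Reach ν ε W t y (t + 1) (y + s • v) := by
      refine Reach.refl.step (W.add_mem hy (W.smul_mem _ hv)) ?_
      rw [add_sub_cancel_left, map_smul_eq_mul, Real.norm_of_nonneg hs0, hsv]
    exact h1.wait hε.le hy (by omega)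
  · have h1 := map_sub_le_add (ν (t + k)) (y + s • v) y
    rw [add_sub_cancel_left, map_smul_eq_mul, Real.norm_of_nonneg hs0] at h1
    have h2 : s * (1 / 2 * ν t v) ≤ s * ν (t + k) v := by gcongr
    nlinarith [apply_nonneg (ν t) y, mul_nonneg hε.le (apply_nonneg (ν t) y)]

/-! ### Building the dichotomy by induction on dimension. -/

/-- An exponential dichotomy on `E` extends by a uniformly growing subspace `F` that stays at a
positive angle to `E`. -/
theorem DichotomyOn.sup (hν : ComparableNorms ν M) {E F : Submodule ℝ X} (hE : DichotomyOn ν E)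
    (hEF : Disjoint E F) {α K : ℝ} (hα : 0 < α) (hK : 0 < K) (hF : UniformGrowth ν F α K)
    (hε : 0 < ε) {T : ℕ} (hangle : ∀ m, T ≤ m → ∀ e ∈ E, ∀ f ∈ F, ε * ν m f ≤ ν m (f + e)) :
    DichotomyOn ν (E ⊔ F) := by
  obtain ⟨L₁, L₂, hdisj, rfl, β, hβ, K', hK', hdec, hgro⟩ := hE
  have hF' := hF.mono (min_le_left α β) (le_max_left K K') hK
  have hL₂ := hgro.mono (min_le_right α β) (le_max_right K K') hK'
  have hα0 : 0 < min α β := lt_min hα hβ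
  have hK0 : 0 < max K K' := lt_max_of_lt_left hK
  -- The angle condition bounds $\nu(e)+\nu(f)$ by $(1+2/\varepsilon)\,\nu(e+f)$; growth by twice
  -- this factor still doubles the sum.
  obtain ⟨N, hN⟩ := ((Real.tendsto_exp_atTop.comp
    (tendsto_natCast_atTop_atTop.const_mul_atTop hα0)).eventually_ge_atTop
      (max K K' * (2 * (1 + 2 / ε)))).and (Filter.eventually_gt_atTop 0) |>.exists
  obtain ⟨γ, hγ, K'', hK'', hgrow⟩ := hν.exists_uniformGrowth (L := L₂ ⊔ F) (T := T) hN.2 (by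
    intro m hm x hx
    obtain ⟨e, he, f, hf, rfl⟩ := Submodule.mem_sup.mp hx
    have h1 := hF' f hf m (m + N) (Nat.le_add_right _ _)
    have h2 := hL₂ e he m (m + N) (Nat.le_add_right _ _)
    have h3 : 2 * (1 + 2 / ε) ≤ (max K K')⁻¹ * Real.exp (min α β * (((m + N : ℕ) : ℝ) - m)) := by
      rw [le_inv_mul_iff₀ hK0]
      simpa using hN.1
    set g := (max K K')⁻¹ * Real.exp (min α β * (((m + N : ℕ) : ℝ) - m)) with hg
    have h4 := hangle (m + N) (by omega) e (le_sup_right (a := L₁) he) f hf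
    rw [add_comm f e] at h4
    have h5 := map_sub_le_add (ν (m + N)) (e + f) f
    rw [add_sub_cancel_right] at h5
    have h6 := map_add_le_add (ν m) e f
    have h7 : ν (m + N) f ≤ 1 / ε * ν (m + N) (e + f) := by
      rw [div_mul_eq_mul_div, one_mul, le_div_iff₀ hε]
      linarith
    have h8 : 0 ≤ 2 / ε := by positivity
    have h9 : 2 * (1 + 2 / ε) * ν m (e + f) ≤ (1 + 2 / ε) * ν (m + N) (e + f) := by
      calc 2 * (1 + 2 / ε) * ν m (e + f) ≤ g * (ν m e + ν m f) := by gcongr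
        _ ≤ ν (m + N) e + ν (m + N) f := by linarith
        _ ≤ (1 + 2 / ε) * ν (m + N) (e + f) := by
          have : 2 / ε = 1 / ε + 1 / ε := by ring
          rw [this]
          linarith
    have h10 : 0 < 1 + 2 / ε := by positivity
    nlinarith)
  refine ⟨L₁, L₂ ⊔ F, hdisj.disjoint_sup_right_of_disjoint_sup_left hEF, (sup_assoc _ _ _).symm,
    min β γ, lt_min hβ hγ, max K' K'', lt_max_of_lt_left hK', ?_, ?_⟩
  · exact hdec.mono (min_le_left _ _) (le_max_left _ _) hK'.le
  · exact hgrow.mono (min_le_right _ _) (le_max_right _ _) hK''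

/-- If no pseudo-orbit has both long intervals of bounded growth and long intervals of bounded
decay, the norms have an exponential dichotomy. -/
theorem dichotomyOn_of_pseudoOrbits [FiniteDimensional ℝ X] (hν : ComparableNorms ν M)
    (hε : 0 < ε) (hε1 : ε < 1)
    (H : ∀ x : ℕ → X, IsPseudoOrbit ν ε x → (∀ n, x n ≠ 0) →
      (∀ k, ∃ n, k ≤ n ∧ ν (n + (k + 1)) (x (n + (k + 1))) ≤ 2 * ν n (x n)) →
      ¬ ∀ k, ∃ n, ε / 8 * ν n (x n) ≤ ν (n + (k + 1)) (x (n + (k + 1)))) (W : Submodule ℝ X) :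
    DichotomyOn ν W := by
  induction hd : Module.finrank ℝ W using Nat.strong_induction_on generalizing W with
  | _ d ih =>
  subst hd
  by_cases hdec : ∃ N T : ℕ, 0 < N ∧ ∀ m, T ≤ m → ∀ x ∈ W, ν (m + N) x ≤ 1 / 2 * ν m x
  · obtain ⟨N, T, hN, h⟩ := hdec
    obtain ⟨α, hα, K, hK, h⟩ := hν.exists_uniformDecay hN h
    refine ⟨W, ⊥, disjoint_bot_right, sup_bot_eq W, α, hα, K, hK, h, ?_⟩
    rintro x hx m n -
    rw [(Submodule.mem_bot ℝ).mp hx]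
    simp
  push Not at hdec
  have hW0 : ∃ y ∈ W, y ≠ 0 := by
    obtain ⟨m, -, x, hx, hlt⟩ := hdec 1 0 one_pos
    exact ⟨x, hx, by rintro rfl; simp at hlt⟩
  -- Slow decay can be reached from every state by `hdec`; were slow growth too, a forbidden
  -- pseudo-orbit would exist.
  have hgood : ∃ m, ∃ y ∈ W, y ≠ 0 ∧ ∃ k : ℕ, ∀ n z, Reach ν ε W m y n z →
      2 * ν n z < ν (n + k) z := by
    by_contra! hG
    obtain ⟨y, hy, hy0⟩ := hW0
    obtain ⟨x, hx, hx0, h1, h2⟩ := exists_nondichotomous_pseudoOrbit hν hε hε1 (c := ε / 8) hy0 hy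
      hG fun m y hy _ k hk => exists_reach_slow_decay hν hε hdec hy hk
    exact H x hx hx0 h1 h2
  obtain ⟨m, y, hy, hy0, k, hgrow⟩ := hgood
  have hk : 0 < k := by
    rcases Nat.eq_zero_or_pos k with rfl | hk
    · have := hgrow m y .refl
      rw [add_zero] at this
      linarith [hν.pos m y hy0]
    · exact hk
  set E := unreachable hν hε hε1 hy0 hy m with hEdef
  have hEW : E ≤ W := fun z hz => hz.1
  -- The state $y$ reaches itself, so the dimension drops.
  have hElt : E < W := lt_of_le_of_ne hEW fun h => by
    have hyE : y ∈ E := h ▸ hy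
    refine hyE.2 m 1 one_ne_zero ?_
    rw [one_smul]
    exact .refl
  have hE := ih _ (Submodule.finrank_lt_finrank_of_lt hElt) E rfl
  obtain ⟨F', hF'⟩ := exists_isCompl E
  have hsup : E ⊔ F' ⊓ W = W := by
    rw [← sup_inf_assoc_of_le _ hEW, hF'.sup_eq_top, top_inf_eq]
  have hdisj : Disjoint E (F' ⊓ W) := hF'.disjoint.mono_right inf_le_left
  obtain ⟨T, hT⟩ := exists_uniform_reach hν hε hy (F' ⊓ W) inf_le_right (m := m) (by
    intro z hz hz0
    by_contra! h
    exact hz0 (Submodule.disjoint_def.mp hdisj z ⟨hz.2, h⟩ hz))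
  obtain ⟨α, hα, K, hK, hF⟩ := hν.exists_uniformGrowth (L := F' ⊓ W) (T := T) hk (by
    intro p hp x hx
    rcases eq_or_ne x 0 with rfl | hx0
    · simp
    obtain ⟨a, ha, h⟩ := hT p hp x hx hx0
    have h1 := hgrow p _ h
    rw [map_smul_eq_mul, map_smul_eq_mul] at h1
    have h2 : 0 < ‖a‖ := norm_pos_iff.mpr ha
    nlinarith)
  rw [← hsup]
  refine hE.sup hν hdisj hα hK hF hε (T := T) ?_
  intro p hp e he f hf
  rcases eq_or_ne f 0 with rfl | hf0
  · simp
  obtain ⟨a, ha, h⟩ := hT p hp f hf hf0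
  -- If $f+e$ were too short, a multiple of $e$ would be one admissible step away from the reachable
  -- multiple of $f$.
  by_contra! hlt
  refine he.2 (p + 1) (-a) (neg_ne_zero.mpr ha) (h.step (W.smul_mem _ (hEW he)) ?_)
  rw [show -a • e - a • f = (-a) • (f + e) by module, map_smul_eq_mul, map_smul_eq_mul, norm_neg]
  nlinarith [norm_nonneg a]

end Norms

/-! ### Pseudo-orbits under an exponential dichotomy. -/

section Roughness

variable {X : Type*} [NormedAddCommGroup X] [NormedSpace ℝ X]
variable {ν : ℕ → Seminorm ℝ X} {M : ℝ}

theorem ComparableNorms.forward_pow (hν : ComparableNorms ν M) (n : ℕ) (x : X) (i : ℕ) :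
    ν (n + i) x ≤ M ^ i * ν n x := by
  have hM0 : 0 < M := by linarith [hν.one_le]
  induction i with
  | zero => simp
  | succ i ih =>
    calc ν (n + i + 1) x ≤ M * ν (n + i) x := hν.forward _ _
      _ ≤ M * (M ^ i * ν n x) := by gcongr
      _ = M ^ (i + 1) * ν n x := by ring

/-- The two subspaces of an exponential dichotomy are at a positive angle, uniformly in time. -/
theorem exists_angle_bound (hν : ComparableNorms ν M) {L₁ L₂ : Submodule ℝ X} {α K : ℝ}
    (hα : 0 < α) (hK : 0 < K) (hdec : UniformDecay ν L₁ α K) (hgro : UniformGrowth ν L₂ α K) :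
    ∃ B : ℝ, 1 ≤ B ∧ ∀ n, ∀ u ∈ L₁, ∀ v ∈ L₂,
      ν n u ≤ B * ν n (u + v) ∧ ν n v ≤ B * ν n (u + v) := by
  have hM0 : 0 < M := by linarith [hν.one_le]
  -- After $j$ steps $v$ has grown by $K+1$ while $u$ has grown by at most $K$, so $u$ and $v$
  -- cannot nearly cancel at time $n$.
  obtain ⟨j, hj⟩ := ((Real.tendsto_exp_atTop.comp
    (tendsto_natCast_atTop_atTop.const_mul_atTop hα)).eventually_ge_atTop (K * (K + 1))).exists
  have hj1 : K * (K + 1) ≤ Real.exp (α * j) := hj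
  have hMj : 0 < M ^ j := by positivity
  refine ⟨M ^ j + K + 1, by linarith, fun n u hu v hv => ?_⟩
  have h1 := hdec u hu n (n + j) (Nat.le_add_right _ _)
  have h2 := hgro v hv n (n + j) (Nat.le_add_right _ _)
  have h3 := hν.forward_pow n (u + v) j
  have h4 := map_sub_le_add (ν (n + j)) (u + v) u
  have h5 := map_sub_le_add (ν n) (u + v) v
  rw [add_sub_cancel_left] at h4
  rw [add_sub_cancel_right] at h5
  rw [Nat.cast_add, add_sub_cancel_left] at h1 h2
  have hexp1 : Real.exp (-α * j) ≤ 1 := Real.exp_le_one_iff.mpr (by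
    have : (0 : ℝ) ≤ j := Nat.cast_nonneg j
    nlinarith)
  have hu0 := apply_nonneg (ν n) u
  have hv0 := apply_nonneg (ν n) v
  have hs0 := apply_nonneg (ν n) (u + v)
  have h6 : K * Real.exp (-α * j) * ν n u ≤ K * ν n u := by
    have := mul_le_mul_of_nonneg_left hexp1 (mul_nonneg hK.le hu0)
    linarith
  have h7 : (K + 1) * ν n v ≤ K⁻¹ * Real.exp (α * j) * ν n v := by
    gcongr
    rwa [le_inv_mul_iff₀ hK]
  have h8 : ν n v ≤ (M ^ j + K) * ν n (u + v) := by nlinarith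
  constructor <;> nlinarith

/-- Over a fixed number of steps, pseudo-orbits with small error stay close to constants. -/
theorem exists_drift_bound (hν : ComparableNorms ν M) (N : ℕ) :
    ∃ C : ℝ, 0 < C ∧ ∀ δ : ℝ, 0 ≤ δ → δ ≤ 1 / 2 → ∀ x, IsPseudoOrbit ν δ x → ∀ m,
      ν (m + N) (x (m + N) - x m) ≤ δ * C * ν m (x m) := by
  have hM1 := hν.one_le
  have hM0 : 0 < M := by linarith
  induction N with
  | zero =>
    refine ⟨1, one_pos, fun δ hδ _ x _ m => ?_⟩
    simpa using mul_nonneg hδ (apply_nonneg (ν m) (x m))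
  | succ N ih =>
    obtain ⟨C, hC, h⟩ := ih
    refine ⟨M * (M ^ N + C) + M * C, by positivity, fun δ hδ hδ1 x hx m => ?_⟩
    have h1 := h δ hδ hδ1 x hx m
    have h2 := hx (m + N)
    have h3 := hν.forward_pow m (x m) N
    have h4 := map_add_le_add (ν (m + N)) (x (m + N) - x m) (x m)
    rw [sub_add_cancel] at h4
    have h5 := map_add_le_add (ν (m + N)) (x (m + N + 1) - x (m + N)) (x (m + N) - x m)
    rw [sub_add_sub_cancel] at h5
    have h6 := hν.forward (m + N) (x (m + N + 1) - x m)
    have h7 : ν (m + N) (x (m + N)) ≤ (M ^ N + C) * ν m (x m) := by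
      nlinarith [mul_nonneg hC.le (apply_nonneg (ν m) (x m))]
    calc ν (m + N + 1) (x (m + N + 1) - x m)
        ≤ M * (δ * ((M ^ N + C) * ν m (x m)) + δ * C * ν m (x m)) := by
          refine h6.trans ?_
          gcongr
          exact h5.trans (add_le_add (h2.trans (by gcongr)) h1)
      _ = δ * (M * (M ^ N + C) + M * C) * ν m (x m) := by ring

/-- Consecutive values of a pseudo-orbit are comparable. -/
theorem IsPseudoOrbit.comparable (hν : ComparableNorms ν M) {δ : ℝ} (hδ : δ ≤ 1 / 2)
    {x : ℕ → X} (hx : IsPseudoOrbit ν δ x) (n : ℕ) :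
    ν (n + 1) (x (n + 1)) ≤ 2 * M * ν n (x n) ∧ ν n (x n) ≤ 2 * M * ν (n + 1) (x (n + 1)) := by
  have hM0 : 0 < M := by linarith [hν.one_le]
  have h1 := hx n
  have h0 := apply_nonneg (ν n) (x n)
  have h2 := map_add_le_add (ν n) (x (n + 1) - x n) (x n)
  have h3 := map_sub_le_add (ν n) (x (n + 1)) (x (n + 1) - x n)
  rw [sub_add_cancel] at h2
  rw [sub_sub_cancel] at h3
  have h4 := hν.forward n (x (n + 1))
  have h5 := hν.backward n (x (n + 1))
  constructor
  · have : ν n (x (n + 1)) ≤ 2 * ν n (x n) := by nlinarith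
    nlinarith
  · have : ν n (x n) ≤ 2 * ν n (x (n + 1)) := by nlinarith
    nlinarith

/-- A sequence with comparable consecutive terms that doubles along an arithmetic progression of
times doubles over every late enough window of a suitable fixed length. -/
theorem exists_doubling_window {M : ℝ} (hM : 1 ≤ M) {N : ℕ} (hN : 0 < N) :
    ∃ N', 0 < N' ∧ ∀ a : ℕ → ℝ, (∀ n, 0 ≤ a n) → (∀ n, a (n + 1) ≤ M * a n) →
      (∀ n, a n ≤ M * a (n + 1)) → ∀ m₀, (∀ j : ℕ, 2 * a (m₀ + j * N) ≤ a (m₀ + j * N + N)) →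
      ∀ m, m₀ ≤ m → 2 * a m ≤ a (m + N') := by
  have hM0 : 0 < M := by linarith
  obtain ⟨l, hl⟩ := pow_unbounded_of_one_lt (2 * M ^ N * M ^ N) (one_lt_two : (1 : ℝ) < 2)
  refine ⟨(l + 1) * N, by positivity, fun a ha hf hb m₀ hd m hm => ?_⟩
  have hpf : ∀ n i, a (n + i) ≤ M ^ i * a n := by
    intro n i
    induction i with
    | zero => simp
    | succ i ih =>
      calc a (n + i + 1) ≤ M * a (n + i) := hf _
        _ ≤ M * (M ^ i * a n) := by gcongr
        _ = M ^ (i + 1) * a n := by ring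
  have hpb : ∀ n i, a n ≤ M ^ i * a (n + i) := by
    intro n i
    induction i with
    | zero => simp
    | succ i ih =>
      calc a n ≤ M ^ i * a (n + i) := ih
        _ ≤ M ^ i * (M * a (n + i + 1)) := by gcongr; exact hb _
        _ = M ^ (i + 1) * a (n + (i + 1)) := by rw [pow_succ, mul_assoc, add_assoc]
  have hdd : ∀ j i : ℕ, 2 ^ i * a (m₀ + j * N) ≤ a (m₀ + (j + i) * N) := by
    intro j i
    induction i with
    | zero => simp
    | succ i ih =>
      have := hd (j + i)
      rw [show m₀ + (j + (i + 1)) * N = m₀ + (j + i) * N + N by ring]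
      calc (2 : ℝ) ^ (i + 1) * a (m₀ + j * N) = 2 * (2 ^ i * a (m₀ + j * N)) := by ring
        _ ≤ 2 * a (m₀ + (j + i) * N) := by gcongr
        _ ≤ _ := this
  obtain ⟨d, rfl⟩ := Nat.exists_eq_add_of_le hm
  have hdiv := Nat.div_add_mod' d N
  have hlt := Nat.mod_lt d hN
  set j := d / N
  set r := d % N
  have h1 : a (m₀ + d) ≤ M ^ N * a (m₀ + j * N) := by
    have := hpf (m₀ + j * N) r
    rw [show m₀ + j * N + r = m₀ + d by omega] at this
    refine this.trans ?_
    have := ha (m₀ + j * N)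
    gcongr
  have h2 : a (m₀ + (j + (l + 1)) * N) ≤ M ^ N * a (m₀ + d + (l + 1) * N) := by
    have := hpf (m₀ + (j + (l + 1)) * N) r
    have h3 := hpb (m₀ + (j + (l + 1)) * N) r
    rw [show m₀ + (j + (l + 1)) * N + r = m₀ + d + (l + 1) * N by rw [← hdiv]; ring] at h3
    refine h3.trans ?_
    have := ha (m₀ + d + (l + 1) * N)
    gcongr
  have h3 := hdd j (l + 1)
  have h4 : 2 * M ^ N * M ^ N * a (m₀ + j * N) ≤ 2 ^ (l + 1) * a (m₀ + j * N) := by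
    have := ha (m₀ + j * N)
    gcongr
    rw [pow_succ]
    linarith [pow_pos (two_pos : (0 : ℝ) < 2) l]
  have h5 : M ^ N * (2 * a (m₀ + d)) ≤ M ^ N * a (m₀ + d + (l + 1) * N) := by
    calc M ^ N * (2 * a (m₀ + d)) ≤ M ^ N * (2 * (M ^ N * a (m₀ + j * N))) := by gcongr
      _ = 2 * M ^ N * M ^ N * a (m₀ + j * N) := by ring
      _ ≤ _ := h4.trans (h3.trans h2)
  exact le_of_mul_le_mul_left h5 (by positivity)

/-- Under an exponential dichotomy, every pseudo-orbit with small error either decays or grows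
uniformly exponentially, at a common rate. -/
theorem exists_pseudoOrbit_dichotomy (hν : ComparableNorms ν M) (hdich : DichotomyOn ν ⊤) :
    ∃ δ : ℝ, 0 < δ ∧ ∃ β : ℝ, 0 < β ∧ ∃ C : ℝ, 0 < C ∧ ∀ x, IsPseudoOrbit ν δ x →
      (∀ m n : ℕ, m ≤ n → ν n (x n) ≤ C * Real.exp (-β * ((n : ℝ) - m)) * ν m (x m)) ∨
      (x 0 ≠ 0 ∧ ∃ c : ℝ, 0 < c ∧ ∀ m n : ℕ, m ≤ n →
        c * Real.exp (β * ((n : ℝ) - m)) * ν m (x m) ≤ ν n (x n)) := by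
  obtain ⟨L₁, L₂, hdisj, hsup, α, hα, K, hK, hdec, hgro⟩ := hdich
  have hcompl : IsCompl L₁ L₂ := ⟨hdisj, codisjoint_iff.mpr hsup⟩
  have hM0 : 0 < M := by linarith [hν.one_le]
  obtain ⟨B, hB, hangle⟩ := exists_angle_bound hν hα hK hdec hgro
  have hB0 : 0 < B := by linarith
  set P := L₁.projection L₂ hcompl with hP
  have hP1 : ∀ x, P x ∈ L₁ := fun x => Submodule.projection_apply_mem hcompl x
  have hP2 : ∀ x, x - P x ∈ L₂ := fun x => Submodule.sub_projection_mem hcompl x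
  have hPB : ∀ n x, ν n (P x) ≤ B * ν n x ∧ ν n (x - P x) ≤ B * ν n x := fun n x => by
    simpa using hangle n _ (hP1 x) _ (hP2 x)
  obtain ⟨N, hN, hN0⟩ := ((Real.tendsto_exp_atTop.comp
    (tendsto_natCast_atTop_atTop.const_mul_atTop hα)).eventually_ge_atTop (K * (8 * B))).and
      (Filter.eventually_gt_atTop 0) |>.exists
  have hN : K * (8 * B) ≤ Real.exp (α * N) := hN
  obtain ⟨C, hC, hdrift⟩ := exists_drift_bound hν N
  -- $N'$ is fixed before the pseudo-orbit, which makes the growth rate common to all of them.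
  obtain ⟨N', hN'0, hN'⟩ := exists_doubling_window (M := 2 * M) (by linarith [hν.one_le]) hN0
  -- Makes the drift over $N$ steps negligible against the contraction $1/(8B)$ and the expansion
  -- $8B$ of the two components.
  set δ := min (1 / 2) (1 / (16 * B ^ 2 * C)) with hδ
  have hδ0 : 0 < δ := lt_min (by norm_num) (by positivity)
  have hδh : δ ≤ 1 / 2 := min_le_left _ _
  have hδC : 16 * B ^ 2 * (δ * C) ≤ 1 := by
    have : δ ≤ 1 / (16 * B ^ 2 * C) := min_le_right _ _
    rw [le_div_iff₀ (by positivity)] at this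
    linarith
  have hlog : 0 < Real.log 2 := Real.log_pos (by norm_num)
  have hNr : (0 : ℝ) < N := by exact_mod_cast hN0
  have hN'r : (0 : ℝ) < N' := by exact_mod_cast hN'0
  set β := min (Real.log 2 / N) (Real.log 2 / N')
  refine ⟨δ, hδ0, β, lt_min (by positivity) (by positivity),
    (2 * M) ^ (N + 0) * Real.exp (Real.log 2 / N * (N + (0 : ℕ))), by positivity, fun x hx => ?_⟩
  have hp : ∀ m, ν (m + N) (P (x (m + N))) ≤
      1 / (8 * B) * ν m (P (x m)) + B * (δ * C) * ν m (x m) := by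
    intro m
    have h1 := hdec _ (hP1 (x m)) m (m + N) (Nat.le_add_right _ _)
    rw [Nat.cast_add, add_sub_cancel_left, neg_mul, Real.exp_neg] at h1
    have h2 := (hPB (m + N) (x (m + N) - x m)).1
    have h3 := hdrift δ hδ0.le hδh x hx m
    have h4 := map_add_le_add (ν (m + N)) (P (x (m + N) - x m)) (P (x m))
    rw [← map_add P, sub_add_cancel] at h4
    have h5 : K * (Real.exp (α * N))⁻¹ ≤ 1 / (8 * B) := by
      rw [← div_eq_mul_inv, div_le_div_iff₀ (Real.exp_pos _) (by positivity)]
      linarith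
    have h6 := mul_le_mul_of_nonneg_right h5 (apply_nonneg (ν m) (P (x m)))
    have h7 := mul_le_mul_of_nonneg_left h3 hB0.le
    linarith
  have hq : ∀ m, 8 * B * ν m (x m - P (x m)) - B * (δ * C) * ν m (x m) ≤
      ν (m + N) (x (m + N) - P (x (m + N))) := by
    intro m
    have h1 := hgro _ (hP2 (x m)) m (m + N) (Nat.le_add_right _ _)
    rw [Nat.cast_add, add_sub_cancel_left] at h1
    have h2 := (hPB (m + N) (x (m + N) - x m)).2
    have h3 := hdrift δ hδ0.le hδh x hx m
    have h4 := map_sub_le_add (ν (m + N)) (x (m + N) - P (x (m + N)))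
      (x (m + N) - x m - P (x (m + N) - x m))
    rw [show x (m + N) - P (x (m + N)) - (x (m + N) - x m - P (x (m + N) - x m)) =
      x m - P (x m) by rw [map_sub]; abel] at h4
    have h5 : 8 * B ≤ K⁻¹ * Real.exp (α * N) := by
      rwa [le_inv_mul_iff₀ hK]
    have h6 := mul_le_mul_of_nonneg_right h5 (apply_nonneg (ν m) (x m - P (x m)))
    have h7 := mul_le_mul_of_nonneg_left h3 hB0.le
    linarith
  have hadd : ∀ m, ν m (x m) ≤ ν m (P (x m)) + ν m (x m - P (x m)) := fun m => by
    simpa using map_add_le_add (ν m) (P (x m)) (x m - P (x m))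
  have hcomp := hx.comparable hν hδh
  have hsmall : 16 * B * (B * (δ * C)) ≤ 1 := by linarith
  have hsmall' : 16 * (B * (δ * C)) ≤ 1 := by
    have : 0 < B * (δ * C) := by positivity
    nlinarith
  have hη0 : 0 < B * (δ * C) := by positivity
  set η := B * (δ * C) with hη
  have hnorm0 : ∀ m, 0 ≤ ν m (x m) := fun m => apply_nonneg _ _
  by_cases hcase : ∀ m, ν m (x m - P (x m)) ≤ ν m (P (x m))
  · left
    intro m n hmn
    have key := exp_decay_of_halving (a := fun n => ν n (x n)) (M := 2 * M) (T := 0)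
      (by linarith [hν.one_le]) hN0 hnorm0 (fun n => (hcomp n).1) (fun m _ => by
        have h1 := hp m
        have h2 := hadd (m + N)
        have h3 := hcase (m + N)
        have h4 := (hPB m (x m)).1
        have h5 : 1 / (8 * B) * ν m (P (x m)) ≤ 1 / 8 * ν m (x m) := by
          rw [div_mul_eq_mul_div, div_le_iff₀ (by positivity)]
          linarith
        have h6 := hnorm0 m
        nlinarith) m n hmn
    refine key.trans ?_
    have h1 : (0 : ℝ) ≤ n - m := sub_nonneg.mpr (by exact_mod_cast hmn)
    have h2 := hnorm0 m
    gcongr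
    exact min_le_left _ _
  · right
    push Not at hcase
    obtain ⟨m₀, hm₀⟩ := hcase
    have hx0 : x 0 ≠ 0 := by
      intro h
      have : ∀ n, ν n (x n) = 0 := by
        intro n
        induction n with
        | zero => simp [h]
        | succ n ih =>
          have := (hcomp n).1
          rw [ih] at this
          linarith [hnorm0 (n + 1)]
      have h1 := (hPB m₀ (x m₀)).2
      rw [this] at h1
      linarith [apply_nonneg (ν m₀) (P (x m₀))]
    -- The unstable cone is invariant under $N$ steps, and on it the norm doubles.
    have hcone : ∀ j : ℕ, ν (m₀ + j * N) (P (x (m₀ + j * N))) ≤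
        ν (m₀ + j * N) (x (m₀ + j * N) - P (x (m₀ + j * N))) := by
      intro j
      induction j with
      | zero => simpa using hm₀.le
      | succ j ih =>
        rw [show m₀ + (j + 1) * N = m₀ + j * N + N by ring]
        generalize m₀ + j * N = m at ih ⊢
        have h1 := hp m
        have h2 := hq m
        have h3 := hadd m
        have h4 := apply_nonneg (ν m) (x m - P (x m))
        have h5 : 1 / (8 * B) * ν m (P (x m)) ≤ ν m (P (x m)) := by
          rw [div_mul_eq_mul_div, div_le_iff₀ (by positivity)]
          nlinarith [apply_nonneg (ν m) (P (x m))]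
        nlinarith
    have hdouble : ∀ j : ℕ, 2 * ν (m₀ + j * N) (x (m₀ + j * N)) ≤
        ν (m₀ + j * N + N) (x (m₀ + j * N + N)) := by
      intro j
      have ih := hcone j
      generalize m₀ + j * N = m at ih ⊢
      have h2 := hq m
      have h3 := hadd m
      have h4 := (hPB (m + N) (x (m + N))).2
      have h5 := apply_nonneg (ν m) (x m - P (x m))
      have h6 : η * ν m (x m) ≤ B * ν m (x m - P (x m)) := by nlinarith
      have h7 : B * (2 * ν m (x m)) ≤ B * ν (m + N) (x (m + N)) := by nlinarith
      exact le_of_mul_le_mul_left h7 hB0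
    have hwin := hN' (fun n => ν n (x n)) hnorm0 (fun n => (hcomp n).1) (fun n => (hcomp n).2)
      m₀ hdouble
    refine ⟨hx0, ((2 * M) ^ (N' + m₀) * Real.exp (Real.log 2 / N' * (N' + m₀)))⁻¹,
      by positivity, fun m n hmn => ?_⟩
    refine le_trans ?_ (exp_growth_of_doubling (a := fun n => ν n (x n)) (M := 2 * M) (T := m₀)
      (by linarith [hν.one_le]) hN'0 hnorm0 (fun n => (hcomp n).2) hwin m n hmn)
    have h1 : (0 : ℝ) ≤ n - m := sub_nonneg.mpr (by exact_mod_cast hmn)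
    have h2 := hnorm0 m
    gcongr
    exact min_le_right _ _

end Roughness

/-! ### Linear systems and their perturbations. -/

section Systems

variable {d : ℕ}

theorem norm_toEuclideanLin_le (A : Mat d) (x : EuclideanSpace ℝ (Fin d)) :
    ‖Matrix.toEuclideanLin A x‖ ≤ ‖A‖ * ‖x‖ := by
  rw [← Matrix.coe_toEuclideanCLM_eq_toEuclideanLin, ← Matrix.l2_opNorm_toEuclideanCLM]
  exact ContinuousLinearMap.le_opNorm _ _

/-- The evolution operator of `x(n+1) = A(n) x(n)` from time `0`. -/
noncomputable def evolution (A : ℕ → Mat d) :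
    ℕ → EuclideanSpace ℝ (Fin d) →ₗ[ℝ] EuclideanSpace ℝ (Fin d)
  | 0 => LinearMap.id
  | n + 1 => Matrix.toEuclideanLin (A n) ∘ₗ evolution A n

theorem solution_eq_evolution (A : ℕ → Mat d) (x : EuclideanSpace ℝ (Fin d)) (n : ℕ) :
    solution A x n = evolution A n x := by
  induction n with
  | zero => rfl
  | succ n ih => simp [solution, evolution, ih]

theorem solution_add (A : ℕ → Mat d) (x y : EuclideanSpace ℝ (Fin d)) (n : ℕ) :
    solution A (x + y) n = solution A x n + solution A y n := by
  simp [solution_eq_evolution]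

/-- The norms `x ↦ ‖x(n, x)‖` of the solutions at time `n`, as functions of the initial value. -/
noncomputable def solutionNorm (A : ℕ → Mat d) (n : ℕ) :
    Seminorm ℝ (EuclideanSpace ℝ (Fin d)) :=
  (normSeminorm ℝ (EuclideanSpace ℝ (Fin d))).comp (evolution A n)

theorem solutionNorm_apply (A : ℕ → Mat d) (n : ℕ) (x : EuclideanSpace ℝ (Fin d)) :
    solutionNorm A n x = ‖evolution A n x‖ := rfl

variable {A : ℕ → Mat d}

theorem IsLyapunovSequence.toEuclideanLin_inv (hA : IsLyapunovSequence A) (n : ℕ)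
    (x : EuclideanSpace ℝ (Fin d)) :
    Matrix.toEuclideanLin (A n)⁻¹ (Matrix.toEuclideanLin (A n) x) = x := by
  have hdet := (Matrix.isUnit_iff_isUnit_det _).mp (hA.1 n)
  rw [← LinearMap.comp_apply, ← Matrix.toLpLin_mul, Matrix.nonsing_inv_mul _ hdet]
  simp

theorem IsLyapunovSequence.evolution_injective (hA : IsLyapunovSequence A) (n : ℕ) :
    Function.Injective (evolution A n) := by
  induction n with
  | zero => exact Function.injective_id
  | succ n ih =>
    exact (Function.LeftInverse.injective (hA.toEuclideanLin_inv n)).comp ih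

theorem IsLyapunovSequence.evolution_surjective (hA : IsLyapunovSequence A) (n : ℕ) :
    Function.Surjective (evolution A n) :=
  LinearMap.injective_iff_surjective.mp (hA.evolution_injective n)

theorem IsLyapunovSequence.exists_comparableNorms (hA : IsLyapunovSequence A) :
    ∃ M, (∀ n, ‖A n‖ ≤ M) ∧ ComparableNorms (solutionNorm A) M := by
  obtain ⟨M₁, h1⟩ := memℓp_infty_iff.mp hA.2.1
  obtain ⟨M₂, h2⟩ := memℓp_infty_iff.mp hA.2.2
  rw [mem_upperBounds, Set.forall_mem_range] at h1 h2
  have hle1 : M₁ ≤ max 1 (max M₁ M₂) := (le_max_left _ _).trans (le_max_right _ _)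
  have hle2 : M₂ ≤ max 1 (max M₁ M₂) := (le_max_right _ _).trans (le_max_right _ _)
  refine ⟨max 1 (max M₁ M₂), fun n => (h1 n).trans hle1, le_max_left _ _, ?_, ?_, ?_, ?_⟩
  · intro n x hx
    rw [solutionNorm_apply, norm_pos_iff]
    exact (map_ne_zero_iff _ (hA.evolution_injective n)).mpr hx
  · intro n x
    exact (norm_toEuclideanLin_le _ _).trans (by
      gcongr
      exacts [(h1 n).trans hle1, le_rfl])
  · intro n x
    have := norm_toEuclideanLin_le (A n)⁻¹ (Matrix.toEuclideanLin (A n) (evolution A n x))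
    rw [hA.toEuclideanLin_inv] at this
    exact this.trans (by gcongr; exacts [(h2 n).trans hle2, le_rfl])
  · intro n
    exact continuous_norm.comp (evolution A n).continuous_of_finiteDimensional

theorem dichotomyOn_top_iff (A : ℕ → Mat d) :
    DichotomyOn (solutionNorm A) ⊤ ↔ HasExponentialDichotomy A := by
  simp only [DichotomyOn, HasExponentialDichotomy, UniformDecay, UniformGrowth,
    isCompl_iff, codisjoint_iff, and_assoc, solutionNorm_apply, solution_eq_evolution]

/-- A pseudo-orbit without zeros is, up to the evolution, a solution of a perturbed system. -/
theorem IsPseudoOrbit.exists_perturbation {M ε : ℝ} (hAM : ∀ n, ‖A n‖ ≤ M)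
    (hM : 0 ≤ M) {x : ℕ → EuclideanSpace ℝ (Fin d)}
    (hx : IsPseudoOrbit (solutionNorm A) ε x) (hx0 : ∀ n, evolution A n (x n) ≠ 0) :
    ∃ Q : ℕ → Mat d, (∀ n, ‖Q n‖ ≤ M * ε) ∧
      ∀ n, solution (fun n => A n + Q n) (x 0) n = evolution A n (x n) := by
  set y := fun n => evolution A n (x n) with hy
  set w := fun n => Matrix.toEuclideanLin (A n) (evolution A n (x (n + 1) - x n)) with hw
  -- $Q(n)=\|y\|^{-2}\,w\,y^{\top}$ sends $y(n)$ to the missing increment $w(n)$ and has norm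
  -- $\|w(n)\|/\|y(n)\|$.
  refine ⟨fun n => (Matrix.toEuclideanCLM (n := Fin d) (𝕜 := ℝ)).symm
    (((‖y n‖ ^ 2)⁻¹ : ℝ) • InnerProductSpace.rankOne ℝ (w n) (y n)), fun n => ?_, fun n => ?_⟩
  · have hyn : 0 < ‖y n‖ := norm_pos_iff.mpr (hx0 n)
    rw [← Matrix.l2_opNorm_toEuclideanCLM, StarAlgEquiv.apply_symm_apply, norm_smul,
      InnerProductSpace.norm_rankOne, norm_inv, Real.norm_of_nonneg (by positivity),
      inv_mul_le_iff₀ (by positivity)]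
    have h1 : ‖w n‖ ≤ M * (ε * ‖y n‖) := (norm_toEuclideanLin_le _ _).trans (by
      have := hx n
      rw [solutionNorm_apply, solutionNorm_apply] at this
      exact mul_le_mul (hAM n) this (norm_nonneg _) hM)
    nlinarith
  · induction n with
    | zero => rfl
    | succ n ih =>
      have hyn : ‖y n‖ ≠ 0 := norm_ne_zero_iff.mpr (hx0 n)
      rw [solution, ih, map_add, LinearMap.add_apply,
        ← Matrix.coe_toEuclideanCLM_eq_toEuclideanLin
          ((Matrix.toEuclideanCLM (n := Fin d) (𝕜 := ℝ)).symm _),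
        StarAlgEquiv.apply_symm_apply]
      have h1 : (((‖y n‖ ^ 2)⁻¹ : ℝ) • InnerProductSpace.rankOne ℝ (w n) (y n)) (y n) = w n := by
        rw [smul_apply, InnerProductSpace.rankOne_apply,
          real_inner_self_eq_norm_sq, smul_smul, inv_mul_cancel₀ (by positivity), one_smul]
      change _ + (((‖y n‖ ^ 2)⁻¹ : ℝ) • InnerProductSpace.rankOne ℝ (w n) (y n)) (y n) = _
      rw [h1]
      simp [hw, evolution]

/-- A solution with both long intervals of bounded growth and long intervals of bounded decay
excludes a Bohl dichotomy. -/
theorem not_hasBohlDichotomy_of_solution {x₀ : EuclideanSpace ℝ (Fin d)} {c : ℝ} (hc : 0 < c)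
    (h0 : ∀ n, solution A x₀ n ≠ 0)
    (hG : ∀ k, ∃ n, k ≤ n ∧ ‖solution A x₀ (n + (k + 1))‖ ≤ 2 * ‖solution A x₀ n‖)
    (hD : ∀ k, ∃ n, c * ‖solution A x₀ n‖ ≤ ‖solution A x₀ (n + (k + 1))‖) :
    ¬ HasBohlDichotomy A := by
  rintro ⟨L₁, L₂, hcompl, α, hα, C₁, C₂, hC₁, hC₂, hdec, hgro⟩
  have hexp : Filter.Tendsto (fun n : ℕ => Real.exp (α * n)) Filter.atTop Filter.atTop :=
    Real.tendsto_exp_atTop.comp (tendsto_natCast_atTop_atTop.const_mul_atTop hα)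
  have hx₀ : x₀ ∈ L₁ ⊔ L₂ := by
    rw [hcompl.sup_eq_top]
    trivial
  obtain ⟨u, hu, v, hv, rfl⟩ := Submodule.mem_sup.mp hx₀
  rcases eq_or_ne v 0 with rfl | hv0
  · rw [add_zero] at h0 hD
    obtain ⟨k, hk⟩ := (hexp.eventually_gt_atTop (C₁ u / c)).exists
    obtain ⟨n, hn⟩ := hD k
    have h1 := hdec u hu n (n + (k + 1)) (Nat.le_add_right _ _)
    rw [Nat.cast_add, add_sub_cancel_left, neg_mul, Real.exp_neg] at h1
    have h2 : 0 < ‖solution A u n‖ := norm_pos_iff.mpr (h0 n)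
    have h3 : C₁ u < c * Real.exp (α * (k + 1 : ℕ)) := by
      rw [div_lt_iff₀ hc] at hk
      have : Real.exp (α * k) ≤ Real.exp (α * (k + 1 : ℕ)) := by
        apply Real.exp_le_exp.mpr
        gcongr
        exact Nat.le_succ k
      nlinarith
    have h4 : C₁ u * (Real.exp (α * (k + 1 : ℕ)))⁻¹ < c := by
      rwa [← div_eq_mul_inv, div_lt_iff₀ (Real.exp_pos _)]
    nlinarith
  · have hvpos : 0 < ‖v‖ := norm_pos_iff.mpr hv0
    have hdom : ∀ᶠ n : ℕ in Filter.atTop, 2 * ‖solution A u n‖ ≤ ‖solution A v n‖ := by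
      filter_upwards [hexp.eventually_ge_atTop (2 * (C₁ u * ‖u‖) / (C₂ v * ‖v‖)),
        hexp.eventually_ge_atTop 1] with n hn hn1
      have h1 := hdec u hu 0 n (Nat.zero_le _)
      have h2 := hgro v hv 0 n (Nat.zero_le _)
      rw [Nat.cast_zero, sub_zero] at h1 h2
      change ‖solution A u n‖ ≤ C₁ u * _ * ‖u‖ at h1
      change C₂ v * _ * ‖v‖ ≤ ‖solution A v n‖ at h2
      have hCu := hC₁ u
      have hCv := hC₂ v
      rw [div_le_iff₀ (by positivity)] at hn
      have h3 : Real.exp (-α * n) ≤ 1 := by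
        rw [neg_mul, Real.exp_neg]
        exact inv_le_one_of_one_le₀ hn1
      have h4 : C₁ u * Real.exp (-α * n) * ‖u‖ ≤ C₁ u * 1 * ‖u‖ := by gcongr
      linarith
    obtain ⟨T, hT⟩ := Filter.eventually_atTop.mp hdom
    -- Once $2\|u\|\le\|v\|$, the solution is between $\tfrac12\|v\|$ and $\tfrac32\|v\|$, so growth
    -- by at most $2$ allows $v$ at most a factor $2\cdot2\cdot\tfrac32=6$.
    obtain ⟨k, hk1, hk2⟩ := ((hexp.eventually_gt_atTop (6 / C₂ v)).and
      (Filter.eventually_ge_atTop T)).exists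
    obtain ⟨n, hkn, hn⟩ := hG k
    have h1 := hgro v hv n (n + (k + 1)) (Nat.le_add_right _ _)
    rw [Nat.cast_add, add_sub_cancel_left] at h1
    have h2 := hT n (by omega)
    have h3 := hT (n + (k + 1)) (by omega)
    have h4 := norm_add_le (solution A u n) (solution A v n)
    have h5 := norm_sub_le (solution A (u + v) (n + (k + 1))) (solution A u (n + (k + 1)))
    have h6 : solution A (u + v) (n + (k + 1)) - solution A u (n + (k + 1)) =
      solution A v (n + (k + 1)) := by rw [solution_add, add_sub_cancel_left]
    rw [h6] at h5
    rw [← solution_add] at h4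
    have h7 : 0 < ‖solution A (u + v) n‖ := norm_pos_iff.mpr (h0 n)
    have h8 : 6 < C₂ v * Real.exp (α * (k + 1 : ℕ)) := by
      rw [div_lt_iff₀ (hC₂ v)] at hk1
      have : Real.exp (α * k) ≤ Real.exp (α * (k + 1 : ℕ)) := by
        apply Real.exp_le_exp.mpr
        gcongr
        exact Nat.le_succ k
      nlinarith [hC₂ v]
    have h9 : 0 < ‖solution A v n‖ := by linarith
    nlinarith

/-- A Lyapunov sequence without exponential dichotomy loses its Bohl dichotomy, if it has one,
under a suitable arbitrarily small perturbation. -/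
theorem IsLyapunovSequence.exists_perturbation (hA : IsLyapunovSequence A)
    (hED : ¬ HasExponentialDichotomy A) {ε : ℝ} (hε : 0 < ε) :
    ∃ Q : ℕ → Mat d, (∀ n, ‖Q n‖ ≤ ε) ∧ ¬ HasBohlDichotomy (fun n => A n + Q n) := by
  obtain ⟨M, hAM, hν⟩ := hA.exists_comparableNorms
  have hM0 : 0 < M := by linarith [hν.one_le]
  set η := min (1 / 2) (ε / M) with hη
  have hη0 : 0 < η := lt_min (by norm_num) (by positivity)
  have hη1 : η < 1 := (min_le_left _ _).trans_lt (by norm_num)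
  have hηε : M * η ≤ ε := by
    have : η ≤ ε / M := min_le_right _ _
    rwa [le_div_iff₀ hM0, mul_comm] at this
  by_contra! H
  refine hED ((dichotomyOn_top_iff A).mp (dichotomyOn_of_pseudoOrbits hν hη0 hη1 ?_ ⊤))
  intro x hx hx0 hG hD
  have hy0 : ∀ n, evolution A n (x n) ≠ 0 := fun n =>
    (map_ne_zero_iff _ (hA.evolution_injective n)).mpr (hx0 n)
  obtain ⟨Q, hQ, hsol⟩ := hx.exists_perturbation hAM hM0.le hy0
  refine not_hasBohlDichotomy_of_solution (x₀ := x 0) (c := η / 8) (by positivity) ?_ ?_ ?_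
    (H Q fun n => (hQ n).trans hηε)
  · intro n
    rw [hsol]
    exact hy0 n
  · intro k
    simp only [hsol]
    exact hG k
  · intro k
    simp only [hsol]
    exact hD k

/-- The initial values of the solutions that tend to zero. -/
def stableSubspace (A : ℕ → Mat d) : Submodule ℝ (EuclideanSpace ℝ (Fin d)) where
  carrier := {x | Filter.Tendsto (solution A x) Filter.atTop (nhds 0)}
  zero_mem' := by
    have : solution A 0 = fun _ => 0 := by
      funext n
      simp [solution_eq_evolution]
    simp [this]
  add_mem' := by
    intro x y hx hy
    have := Filter.Tendsto.add hx hy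
    rw [add_zero] at this
    refine this.congr fun n => ?_
    rw [solution_add]
  smul_mem' := by
    intro c x hx
    have := Filter.Tendsto.const_smul hx c
    rw [smul_zero] at this
    refine this.congr fun n => ?_
    simp [solution_eq_evolution]

/-- Every small perturbation of a Lyapunov sequence with an exponential dichotomy has a Bohl
dichotomy. -/
theorem IsLyapunovSequence.hasBohlDichotomy_add (hA : IsLyapunovSequence A)
    (hED : HasExponentialDichotomy A) :
    ∃ ε : ℝ, 0 < ε ∧ ∀ Q : ℕ → Mat d, (∀ n, ‖Q n‖ ≤ ε) →
      HasBohlDichotomy (fun n => A n + Q n) := by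
  obtain ⟨M, -, hν⟩ := hA.exists_comparableNorms
  have hM0 : 0 < M := by linarith [hν.one_le]
  obtain ⟨δ, hδ, β, hβ, C, hC, hall⟩ :=
    exists_pseudoOrbit_dichotomy hν ((dichotomyOn_top_iff A).mpr hED)
  -- The increment caused by $Q(n)$ is seen at time $n+1$; measuring it at time $n$ costs a factor
  -- $M$.
  refine ⟨δ / M, by positivity, fun Q hQ => ?_⟩
  set B : ℕ → Mat d := fun n => A n + Q n with hB
  have hsol : ∀ x₀, (∀ m n : ℕ, m ≤ n → ‖solution B x₀ n‖ ≤
        C * Real.exp (-β * ((n : ℝ) - m)) * ‖solution B x₀ m‖) ∨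
      (x₀ ≠ 0 ∧ ∃ c : ℝ, 0 < c ∧ ∀ m n : ℕ, m ≤ n →
        c * Real.exp (β * ((n : ℝ) - m)) * ‖solution B x₀ m‖ ≤ ‖solution B x₀ n‖) := by
    intro x₀
    choose x hx using fun n => hA.evolution_surjective n (solution B x₀ n)
    have hx0 : x 0 = x₀ := hx 0
    have hps : IsPseudoOrbit (solutionNorm A) δ x := by
      intro n
      have h1 := hν.backward n (x (n + 1) - x n)
      have h2 : evolution A (n + 1) (x (n + 1) - x n) =
          Matrix.toEuclideanLin (Q n) (solution B x₀ n) := by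
        rw [map_sub, hx (n + 1)]
        change Matrix.toEuclideanLin (A n + Q n) (solution B x₀ n) -
          Matrix.toEuclideanLin (A n) (evolution A n (x n)) = _
        rw [hx n, map_add, LinearMap.add_apply, add_sub_cancel_left]
      have h3 := (norm_toEuclideanLin_le (Q n) (solution B x₀ n)).trans
        (mul_le_mul_of_nonneg_right (hQ n) (norm_nonneg _))
      rw [solutionNorm_apply A (n + 1), h2] at h1
      rw [solutionNorm_apply A n (x n), hx n]
      refine h1.trans ((mul_le_mul_of_nonneg_left h3 hM0.le).trans_eq ?_)
      field_simp
    have := hall x hps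
    simp only [solutionNorm_apply, hx, hx0] at this
    exact this
  -- Any complement serves: each solution decays or grows, and the decaying ones all start in the
  -- stable subspace.
  obtain ⟨L₂, hL₂⟩ := Submodule.exists_isCompl (stableSubspace B)
  have hdec : ∀ x₀, ∃ C₁ : ℝ, 0 < C₁ ∧ (x₀ ∈ stableSubspace B → ∀ m n : ℕ, m ≤ n →
      ‖solution B x₀ n‖ ≤ C₁ * Real.exp (-β * ((n : ℝ) - m)) * ‖solution B x₀ m‖) := by
    intro x₀
    refine ⟨C, hC, fun hx => ?_⟩
    rcases hsol x₀ with h | ⟨h0, c, hc, h⟩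
    · exact h
    exfalso
    have hlim : Filter.Tendsto (fun n => ‖solution B x₀ n‖) Filter.atTop (nhds 0) :=
      tendsto_zero_iff_norm_tendsto_zero.mp hx
    have hpos : 0 < c * ‖x₀‖ := mul_pos hc (norm_pos_iff.mpr h0)
    obtain ⟨n, hn⟩ := (hlim.eventually (gt_mem_nhds hpos)).exists
    have h1 := h 0 n (Nat.zero_le n)
    rw [Nat.cast_zero, sub_zero] at h1
    change c * _ * ‖x₀‖ ≤ _ at h1
    have h2 : 1 ≤ Real.exp (β * n) := Real.one_le_exp (by positivity)
    nlinarith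
  have hgro : ∀ x₀, ∃ C₂ : ℝ, 0 < C₂ ∧ (x₀ ∈ L₂ → ∀ m n : ℕ, m ≤ n →
      C₂ * Real.exp (β * ((n : ℝ) - m)) * ‖solution B x₀ m‖ ≤ ‖solution B x₀ n‖) := by
    intro x₀
    rcases hsol x₀ with h | ⟨-, c, hc, h⟩
    · refine ⟨1, one_pos, fun hx m n _ => ?_⟩
      have hst : x₀ ∈ stableSubspace B := by
        have h1 : Filter.Tendsto (fun n : ℕ => C * Real.exp (-(β * n)) * ‖x₀‖)
            Filter.atTop (nhds (C * 0 * ‖x₀‖)) :=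
          ((Real.tendsto_exp_neg_atTop_nhds_zero.comp
            (tendsto_natCast_atTop_atTop.const_mul_atTop hβ)).const_mul C).mul_const _
        rw [mul_zero, zero_mul] at h1
        refine squeeze_zero_norm (fun n => ?_) h1
        have h2 := h 0 n (Nat.zero_le n)
        rwa [Nat.cast_zero, sub_zero, neg_mul] at h2
      rw [Submodule.disjoint_def.mp hL₂.disjoint x₀ hst hx]
      simp [solution_eq_evolution]
    · exact ⟨c, hc, fun _ => h⟩
  choose C₁ hC₁ hdec using hdec
  choose C₂ hC₂ hgro using hgro
  exact ⟨stableSubspace B, L₂, hL₂, β, hβ, C₁, C₂, hC₁, hC₂, hdec, hgro⟩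

theorem IsLyapunovSequence.exp_smul (hA : IsLyapunovSequence A) (γ : ℝ) :
    IsLyapunovSequence (fun n => Real.exp γ • A n) := by
  have hinv : ∀ n, (Real.exp γ • A n)⁻¹ = (Real.exp γ)⁻¹ • (A n)⁻¹ := by
    intro n
    have hdet := (Matrix.isUnit_iff_isUnit_det _).mp (hA.1 n)
    apply Matrix.inv_eq_left_inv
    rw [smul_mul_smul_comm, inv_mul_cancel₀ (Real.exp_pos γ).ne', Matrix.nonsing_inv_mul _ hdet,
      one_smul]
  refine ⟨fun n => (hA.1 n).smul (Units.mk0 _ (Real.exp_pos γ).ne'),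
    hA.2.1.const_smul (Real.exp γ), ?_⟩
  simp only [hinv]
  exact hA.2.2.const_smul (Real.exp γ)⁻¹

end Systems

end BohlED

theorem mainTheorem2 (d : ℕ) (A : ℕ → BohlED.Mat d) (hA : BohlED.IsLyapunovSequence A) :
    (⋂ (ε : ℝ) (_ : 0 < ε), ⋃ (Q : BohlED.BddSeq d) (_ : ‖Q‖ < ε),
        BohlED.bohlDichotomySpectrum (fun n => A n + Q n)) =
      BohlED.expDichotomySpectrum A := by
  ext γ
  simp only [Set.mem_iInter, Set.mem_iUnion, BohlED.bohlDichotomySpectrum,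
    BohlED.expDichotomySpectrum, Set.mem_ofPred_eq, smul_add, exists_prop]
  have hγ := hA.exp_smul (-γ)
  have hpos := Real.exp_pos (-γ)
  constructor
  · intro h hED
    obtain ⟨ε, hε, hBD⟩ := hγ.hasBohlDichotomy_add hED
    obtain ⟨Q, hQ, hnot⟩ := h (ε / Real.exp (-γ)) (by positivity)
    refine hnot (hBD (fun n => Real.exp (-γ) • Q n) fun n => ?_)
    rw [norm_smul, Real.norm_of_nonneg hpos.le, mul_comm, ← le_div_iff₀ hpos]
    exact (lp.norm_apply_le_norm ENNReal.top_ne_zero Q n).trans hQ.le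
  · intro hED ε hε
    -- Rescaling by $e^{\gamma}$ turns this bound into $\varepsilon/2$, which keeps the supremum
    -- strictly below $\varepsilon$.
    obtain ⟨Q, hQ, hnot⟩ := hγ.exists_perturbation hED (ε := Real.exp (-γ) * (ε / 2))
      (by positivity)
    have hQ' : ∀ n, ‖(Real.exp (-γ))⁻¹ • Q n‖ ≤ ε / 2 := fun n => by
      rw [norm_smul, norm_inv, Real.norm_of_nonneg hpos.le, inv_mul_le_iff₀ hpos]
      exact hQ n
    have hmem : Memℓp (fun n => (Real.exp (-γ))⁻¹ • Q n) ∞ :=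
      memℓp_infty_iff.mpr ⟨ε / 2, Set.forall_mem_range.mpr hQ'⟩
    refine ⟨⟨_, hmem⟩, ?_, ?_⟩
    · exact (lp.norm_le_of_forall_le (by positivity) hQ').trans_lt (by linarith)
    · simpa [smul_smul, mul_inv_cancel₀ hpos.ne'] using hnot
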